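/- **Setting.** Let $x_1,\dots,x_n\in\mathbb R^d$, $y_1,\dots,y_n\in\mathbb R$, and assume that the set of interpolators $\mathcal S=\{\beta:\langle\beta,x_i\rangle=y_i\ \forall i\}$ is non-empty. Let $1\le b\le n$. For a batch $\mathcal B\subset[n]$ of size $b$ put $$\mathcal L_{\mathcal B}(\beta)=\frac1{2b}\sum_{i\in\mathcal B}(\langle\beta,x_i\rangle-y_i)^2,\quad \mathcal L(\beta)=\frac1{2n}\sum_{i=1}^n(\langle\beta,x_i\rangle-y_i)^2,\quad H_{\mathcal B}=\frac1b\sum_{i\in\mathcal B}x_ix_i^\top,\quad H=\frac1n\sum_{i=1}^nx_ix_i^\top .$$ Let $\lambda_b$ be the largest and $\Lambda_b$ the smallest number with $\lambda_bH\preceq\mathbb E_{\mathcal B}[H_{\mathcal B}^2]\preceq\Lambda_bH$, where $\mathcal B$ is uniform among the batches of size $b$ (if $H=0$, put $\lambda_b=\Lambda_b=0$). Let $L>0$ be any number with $\|H_{\mathcal B}\beta\|_2\le L\|\beta\|_2$ and $\|H_{\mathcal B}\beta\|_\infty\le L\|\beta\|_\infty$ for all $\beta\in\mathbb R^d$ and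 all batches $\mathcal B$ of size $b$. Let $\beta^\star_{\ell_1}\in\mathcal S$ be an interpolator of minimal $\ell_1$ norm. For $\alpha,\gamma>0$ consider mini-batch SGD on $(u,v)\mapsto\mathcal L(u\odot v)$ with constant stepsize $\gamma$ and batches $\mathcal B_0,\mathcal B_1,\dots$ of size $b$: $u_0=\sqrt2\,\alpha\mathbf 1$, $v_0=\mathbf 0$, $$(u_{k+1},v_{k+1})=(u_k,v_k)-\gamma\,\nabla_{(u,v)}\big[\mathcal L_{\mathcal B_k}(u\odot v)\big](u_k,v_k),\qquad \beta_k=u_k\odot v_k .$$ The gain vector is $\mathrm{Gain}_\gamma=\sum_{k\ge0}q(\gamma\nabla\mathcal L_{\mathcal B_k}(\beta_k))$, where $q(t)=-\tfrac12\ln((1-t^2)^2)$, with $q(\pm1)=\infty$, acts coordinatewise. Expectations are over batches that are sampled independently and uniformly among the sets of $b$ samples. All expectations and sums below are taken in $[0,\infty]$. **Proposition.** (1) Let $\alpha,\gamma>0$ be such that $\|\gamma\nabla\mathcal L_{\mathcal B_k}(\beta_k)\|_\infty\le\frac12$ for all $k$ and all batch sequences. Then $$\lambda_b\,\gamma^2\,\mathbb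 E\Big[\sum_k\mathcal L(\beta_k)\Big]\ \le\ \mathbb E\big[\|\mathrm{Gain}_\gamma\|_1\big]\ \le\ 4\Lambda_b\,\gamma^2\,\mathbb E\Big[\sum_k\mathcal L(\beta_k)\Big].$$ (2) There are numerical constants $c,C_1,C_2>0$ such that for all data $(x_i,y_i)_{i\le n}$ as above and every $\beta^\star_{\ell_1}$ there is $\alpha_0>0$, depending only on these, such that for all $0<\alpha\le\alpha_0$, all $1\le b\le n$ and all $L$ as above: (a) with $B=3\|\beta^\star_{\ell_1}\|_1\ln\!\big(1+\|\beta^\star_{\ell_1}\|_1/\alpha^2\big)$ and any stepsize $\gamma>0$ with $\gamma BL\le c$, one has $\|\beta^\star_{\ell_1}\|_\infty\le B$, and $\|\beta_k\|_\infty\le B$ for all $k$ and all batch sequences; (b) for every $B\ge\|\beta^\star_{\ell_1}\|_\infty$ and every stepsize $\gamma>0$ with $\gamma BL\le c$ for which $\|\beta_k\|_\infty\le B$ holds for all $k$ and all batch sequences (in particular for $B$ and $\gamma$ as in (a)), one has $\|\gamma\nabla\mathcal L_{\mathcal B_k}(\beta_k)\|_\infty\le\frac12$ for all $k$ and all batch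 sequences, so that the bounds of (1) hold, and $$C_1\,\gamma\ln\!\big(\tfrac1\alpha\big)\|\beta^\star_{\ell_1}\|_1\ \le\ \gamma^2\,\mathbb E\Big[\sum_k\mathcal L(\beta_k)\Big]\ \le\ C_2\,\gamma\ln\!\big(\tfrac1\alpha\big)\|\beta^\star_{\ell_1}\|_1 .$$ -/

import Mathlib

open MeasureTheory ProbabilityTheory
open scoped ENNReal Matrix

namespace DLN

/-- Mini-batches: sets of `b` distinct samples out of `n`. -/
def Batch (n b : ℕ) : Type := {B : Finset (Fin n) // B.card = b}

instance (n b : ℕ) : Fintype (Batch n b) :=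
  inferInstanceAs (Fintype {B : Finset (Fin n) // B.card = b})

instance (n b : ℕ) : MeasurableSpace (Batch n b) := ⊤

/-- The random batches `𝓑 0, 𝓑 1, …` are sampled independently, each of them uniformly
among the sets of `b` samples. -/
structure IsUniformSampling {n b : ℕ} {Ω : Type*} [MeasurableSpace Ω] (P : Measure Ω)
    (𝓑 : ℕ → Ω → Batch n b) : Prop where
  measurable : ∀ k, Measurable (𝓑 k)
  uniform : ∀ k, P.map (𝓑 k) = uniformOn Set.univ
  indep : iIndepFun 𝓑 P

section Data

variable {n d : ℕ} (x : Fin n → Fin d → ℝ) (y : Fin n → ℝ)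

/-- The set `S` of interpolators. -/
def interpolators : Set (Fin d → ℝ) := {β | ∀ i, β ⬝ᵥ x i = y i}

/-- The `ℓ¹` norm. -/
def l1Norm (β : Fin d → ℝ) : ℝ := ∑ j, |β j|

/-- `β` is an interpolator of minimal `ℓ¹` norm. -/
def IsMinL1Interpolator (β : Fin d → ℝ) : Prop :=
  β ∈ interpolators x y ∧ ∀ β' ∈ interpolators x y, l1Norm β ≤ l1Norm β'

/-- The quadratic loss over the whole data set. -/
noncomputable def loss (β : Fin d → ℝ) : ℝ :=
  1 / (2 * (n : ℝ)) * ∑ i, (β ⬝ᵥ x i - y i) ^ 2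

/-- The quadratic loss over a batch. -/
noncomputable def batchLoss (B : Finset (Fin n)) (β : Fin d → ℝ) : ℝ :=
  1 / (2 * (B.card : ℝ)) * ∑ i ∈ B, (β ⬝ᵥ x i - y i) ^ 2

/-- The gradient of `batchLoss x y B`; see `hasFDerivAt_batchLoss`. -/
noncomputable def batchGrad (B : Finset (Fin n)) (β : Fin d → ℝ) : Fin d → ℝ :=
  fun j => 1 / (B.card : ℝ) * ∑ i ∈ B, (β ⬝ᵥ x i - y i) * x i j

/-- The loss over a batch as a function of the neurons `w = (u, v)`, with `β = u ⊙ v`. -/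
noncomputable def neuronLoss (B : Finset (Fin n)) (w : (Fin d → ℝ) × (Fin d → ℝ)) : ℝ :=
  batchLoss x y B (w.1 * w.2)

/-- The gradient of `neuronLoss x y B`; see `hasFDerivAt_neuronLoss`. -/
noncomputable def neuronGrad (B : Finset (Fin n)) (w : (Fin d → ℝ) × (Fin d → ℝ)) :
    (Fin d → ℝ) × (Fin d → ℝ) :=
  (batchGrad x y B (w.1 * w.2) * w.2, batchGrad x y B (w.1 * w.2) * w.1)

/-- The linear form `h ↦ ⟨g, h⟩`. -/
noncomputable def dotForm (g : Fin d → ℝ) : (Fin d → ℝ) →L[ℝ] ℝ :=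
  ∑ j, g j • ContinuousLinearMap.proj (R := ℝ) (φ := fun _ : Fin d => ℝ) j

theorem dotForm_apply (g h : Fin d → ℝ) : dotForm g h = g ⬝ᵥ h := by
  simp [dotForm, dotProduct]

theorem hasFDerivAt_batchLoss (B : Finset (Fin n)) (β : Fin d → ℝ) :
    HasFDerivAt (batchLoss x y B) (dotForm (batchGrad x y B β)) β := by
  have h1 : ∀ i, HasFDerivAt (fun β' : Fin d → ℝ => β' ⬝ᵥ x i - y i) (dotForm (x i)) β := by
    intro i
    have h := (dotForm (x i)).hasFDerivAt (x := β)
    have h2 : (fun β' : Fin d → ℝ => β' ⬝ᵥ x i - y i) = fun β' => dotForm (x i) β' - y i := by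
      funext β'
      rw [dotForm_apply, dotProduct_comm]
    rw [h2]
    exact h.sub_const _
  have h3 := (HasFDerivAt.fun_sum (u := B) (fun i _ => (h1 i).pow 2)).const_mul
    (1 / (2 * (B.card : ℝ)))
  unfold batchLoss
  refine h3.congr_fderiv ?_
  ext h
  simp only [dotForm_apply, smul_apply, sum_apply,
    dotProduct, batchGrad, smul_eq_mul, Finset.mul_sum, Finset.sum_mul, nsmul_eq_mul]
  rw [Finset.sum_comm]
  refine Finset.sum_congr rfl fun j _ => Finset.sum_congr rfl fun i _ => ?_
  norm_num
  ring

theorem hasFDerivAt_neuronLoss (B : Finset (Fin n)) (w : (Fin d → ℝ) × (Fin d → ℝ)) :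
    HasFDerivAt (neuronLoss x y B)
      ((dotForm (neuronGrad x y B w).1).coprod (dotForm (neuronGrad x y B w).2)) w := by
  have h0 : ∀ j, HasFDerivAt (fun w : (Fin d → ℝ) × (Fin d → ℝ) => w.1 j * w.2 j) _ w :=
    fun j => (((ContinuousLinearMap.proj (R := ℝ) (φ := fun _ : Fin d => ℝ) j).comp
      (ContinuousLinearMap.fst ℝ (Fin d → ℝ) (Fin d → ℝ))).hasFDerivAt (x := w)).mul
      (((ContinuousLinearMap.proj (R := ℝ) (φ := fun _ : Fin d => ℝ) j).comp
      (ContinuousLinearMap.snd ℝ (Fin d → ℝ) (Fin d → ℝ))).hasFDerivAt (x := w))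
  have h1 : HasFDerivAt (fun w : (Fin d → ℝ) × (Fin d → ℝ) => w.1 * w.2) _ w :=
    hasFDerivAt_pi.2 h0
  refine ((hasFDerivAt_batchLoss x y B (w.1 * w.2)).comp w h1).congr_fderiv ?_
  apply ContinuousLinearMap.ext
  intro h
  simp only [ContinuousLinearMap.comp_apply, ContinuousLinearMap.coprod_apply, dotForm_apply,
    dotProduct, neuronGrad, Pi.mul_apply, ← Finset.sum_add_distrib]
  refine Finset.sum_congr rfl fun j _ => ?_
  simp
  ring

/-- Mini-batch SGD with constant stepsize `γ` on the neurons `w = (u, v)` along the batches `𝓑`,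
initialised at `u₀ = √2 α 𝟏`, `v₀ = 0`. -/
noncomputable def neurons {b : ℕ} (α γ : ℝ) (𝓑 : ℕ → Batch n b) :
    ℕ → (Fin d → ℝ) × (Fin d → ℝ)
  | 0 => (fun _ => √2 * α, 0)
  | k + 1 => neurons α γ 𝓑 k - γ • neuronGrad x y (𝓑 k).1 (neurons α γ 𝓑 k)

/-- The prediction parameters `β_k = u_k ⊙ v_k`. -/
noncomputable def iterate {b : ℕ} (α γ : ℝ) (𝓑 : ℕ → Batch n b) (k : ℕ) : Fin d → ℝ :=
  (neurons x y α γ 𝓑 k).1 * (neurons x y α γ 𝓑 k).2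

/-- The scaled stochastic gradients `γ ∇L_{B_k}(β_k)`. -/
noncomputable def scaledGrad {b : ℕ} (α γ : ℝ) (𝓑 : ℕ → Batch n b) (k : ℕ) : Fin d → ℝ :=
  γ • batchGrad x y (𝓑 k).1 (iterate x y α γ 𝓑 k)

end Data

/-- `q(t) = -½ ln((1 - t²)²)`, with `q(±1) = ∞`. -/
noncomputable def q (t : ℝ) : EReal :=
  if t ^ 2 = 1 then ⊤ else ((-(1 / 2) * Real.log ((1 - t ^ 2) ^ 2) : ℝ) : EReal)

section Gain

variable {n d b : ℕ} (x : Fin n → Fin d → ℝ) (y : Fin n → ℝ) (α γ : ℝ)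

/-- The gain vector `∑ₖ q(γ ∇L_{B_k}(β_k))`, with entries in `[0, ∞]`. It is meant for
trajectories whose scaled gradients have entries in `[-√2, √2]`, where `q ≥ 0` and
`EReal.toENNReal` loses nothing. -/
noncomputable def gain (𝓑 : ℕ → Batch n b) (j : Fin d) : ℝ≥0∞ :=
  ∑' k, (q (scaledGrad x y α γ 𝓑 k j)).toENNReal

/-- The expected `ℓ¹` norm of the gain vector. -/
noncomputable def expectedGain {Ω : Type*} [MeasurableSpace Ω] (P : Measure Ω)
    (𝓑 : ℕ → Ω → Batch n b) : ℝ≥0∞ :=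
  ∫⁻ ω, ∑ j, gain x y α γ (fun k => 𝓑 k ω) j ∂P

/-- The expectation of `∑ₖ L(β_k)`. -/
noncomputable def expectedLossSum {Ω : Type*} [MeasurableSpace Ω] (P : Measure Ω)
    (𝓑 : ℕ → Ω → Batch n b) : ℝ≥0∞ :=
  ∫⁻ ω, ∑' k, ENNReal.ofReal (loss x y (iterate x y α γ (fun k => 𝓑 k ω) k)) ∂P

end Gain

section Constants

variable {n d : ℕ} (x : Fin n → Fin d → ℝ)

/-- The Hessian `H_B` of the loss over a batch. -/
noncomputable def batchHessian (B : Finset (Fin n)) : Matrix (Fin d) (Fin d) ℝ :=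
  (1 / (B.card : ℝ)) • ∑ i ∈ B, Matrix.vecMulVec (x i) (x i)

/-- The Hessian `H` of the loss. -/
noncomputable def hessian : Matrix (Fin d) (Fin d) ℝ :=
  (1 / (n : ℝ)) • ∑ i, Matrix.vecMulVec (x i) (x i)

/-- `E_B[H_B²]` for a uniformly sampled batch `B` of size `b`. -/
noncomputable def meanSqHessian (b : ℕ) : Matrix (Fin d) (Fin d) ℝ :=
  (1 / (Fintype.card (Batch n b) : ℝ)) • ∑ B : Batch n b, batchHessian x B.1 ^ 2

/-- `λ_b`: the largest `l` with `l H ⪯ E_B[H_B²]`. -/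
noncomputable def lamMin (b : ℕ) : ℝ :=
  sSup {l : ℝ | (meanSqHessian x b - l • hessian x).PosSemidef}

/-- `Λ_b`: the smallest `l` with `E_B[H_B²] ⪯ l H`. -/
noncomputable def lamMax (b : ℕ) : ℝ :=
  sInf {l : ℝ | (l • hessian x - meanSqHessian x b).PosSemidef}

/-- `L` bounds all batch Hessians of size `b` in the `ℓ²` and in the `ℓ^∞` operator norm. -/
structure IsSmoothness (b : ℕ) (L : ℝ) : Prop where
  pos : 0 < L
  l2 : ∀ (B : Batch n b) (β : Fin d → ℝ),
    √(∑ j, (batchHessian x B.1 *ᵥ β) j ^ 2) ≤ L * √(∑ j, β j ^ 2)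
  linf : ∀ (B : Batch n b) (β : Fin d → ℝ), ‖batchHessian x B.1 *ᵥ β‖ ≤ L * ‖β‖

end Constants

end DLN

namespace DLN

/-! ### Quadratic forms of the Hessians -/

section Quadratic

variable {n d b : ℕ} (x : Fin n → Fin d → ℝ)

/-! In the variables `p = ((u + v) / 2)²` and `m = ((u - v) / 2)²` the iterate is `β = p - m`, and
SGD is a multiplicative update: with `t` the scaled stochastic gradient, `p` is multiplied by `(1 -
t)²` and `m` by `(1 + t)²`. Every interpolator `β'` therefore has a natural Lyapunov function, the
relative entropy `∑ (p + m - β'₊ log p - β'₋ log m)`. As long as `|t| ≤ 1/2`, one step changes it by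
`-4γ` times the batch loss, up to an error `t² (p + m + 4|β'|) ≥ 0` per coordinate. Co-coercivity of
the batch Hessian (`IsSmoothness.sum_sq_le`) bounds `∑ t²` by the same batch loss, so for bounded
iterates and `γBL` small the error costs at most half of the decrease.

Upper bounds come from this decrease with `β' = βs`. The potential is at least `S - A log S`, where
`S` is the total mass and `A = ‖βs‖₁`. This confines `S`, hence the iterates (`norm_iterate_le`),
and limits the accumulated batch losses (`sum_batchLoss_le`).

For the lower bound (`le_of_forall_sum_batchLoss_le`) the comparison point is a limit point of the
trajectory itself. If the losses tend to zero, it is an interpolator `β∞`, with `‖β∞‖₁ ≥ A` by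
minimality. Its own potential starts near `2 ‖β∞‖₁ log(1/α)` and is much smaller in the limit, while
each step lowers it by at most `4γ` times the batch loss.

Both estimates are pathwise. Independence enters through `IsUniformSampling.lintegral_eq`: averaging
the current batch turns batch losses into losses, and squared gradients into the quadratic form of
`E[H_B²]`. The latter, with `t² ≤ q(t) ≤ 2t²`, gives the comparison of gain and loss
(`expectedGain_bounds`). -/

theorem batchHessian_mulVec_apply (B : Finset (Fin n)) (v : Fin d → ℝ) (j : Fin d) :
    (batchHessian x B *ᵥ v) j = 1 / (B.card : ℝ) * ∑ i ∈ B, (v ⬝ᵥ x i) * x i j := by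
  simp only [batchHessian, Matrix.smul_mulVec, Matrix.sum_mulVec, Matrix.vecMulVec_mulVec,
    Pi.smul_apply, Finset.sum_apply, smul_eq_mul, MulOpposite.smul_eq_mul_unop,
    MulOpposite.unop_op]
  congr 1
  exact Finset.sum_congr rfl fun i _ => by rw [dotProduct_comm, mul_comm]

theorem dotProduct_batchHessian_mulVec (B : Finset (Fin n)) (v w : Fin d → ℝ) :
    v ⬝ᵥ (batchHessian x B *ᵥ w) =
      1 / (B.card : ℝ) * ∑ i ∈ B, (v ⬝ᵥ x i) * (w ⬝ᵥ x i) := by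
  simp only [batchHessian, Matrix.smul_mulVec, Matrix.sum_mulVec, Matrix.vecMulVec_mulVec,
    dotProduct_smul, dotProduct_sum, smul_eq_mul, MulOpposite.smul_eq_mul_unop,
    MulOpposite.unop_op]
  congr 1
  exact Finset.sum_congr rfl fun i _ => by rw [dotProduct_comm (x i) w]

theorem dotProduct_hessian_mulVec (v : Fin d → ℝ) :
    v ⬝ᵥ (hessian x *ᵥ v) = 1 / (n : ℝ) * ∑ i, (v ⬝ᵥ x i) ^ 2 := by
  have h : hessian x = batchHessian x Finset.univ := by
    simp [hessian, batchHessian]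
  rw [h, dotProduct_batchHessian_mulVec]
  simp [sq]

theorem batchHessian_isSymm (B : Finset (Fin n)) : (batchHessian x B)ᵀ = batchHessian x B := by
  simp [batchHessian, Matrix.transpose_sum, Matrix.transpose_vecMulVec]

theorem dotProduct_meanSqHessian_mulVec (b : ℕ) (v : Fin d → ℝ) :
    v ⬝ᵥ (meanSqHessian x b *ᵥ v) = 1 / (Fintype.card (Batch n b) : ℝ) *
      ∑ B : Batch n b, ∑ j, (batchHessian x B.1 *ᵥ v) j ^ 2 := by
  simp only [meanSqHessian, Matrix.smul_mulVec, Matrix.sum_mulVec, dotProduct_smul,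
    dotProduct_sum, smul_eq_mul]
  congr 1
  refine Finset.sum_congr rfl fun B _ => ?_
  rw [sq, ← Matrix.mulVec_mulVec, Matrix.dotProduct_mulVec, ← Matrix.mulVec_transpose,
    batchHessian_isSymm]
  simp [dotProduct, sq]

theorem meanSqHessian_isHermitian (b : ℕ) : (meanSqHessian x b).IsHermitian := by
  rw [Matrix.IsHermitian, Matrix.conjTranspose_eq_transpose_of_trivial]
  simp [meanSqHessian, Matrix.transpose_sum, Matrix.transpose_pow, batchHessian_isSymm]

theorem hessian_isHermitian : (hessian x).IsHermitian := by
  rw [Matrix.IsHermitian, Matrix.conjTranspose_eq_transpose_of_trivial]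
  simp [hessian, Matrix.transpose_sum, Matrix.transpose_vecMulVec]

theorem posSemidef_meanSqHessian_sub_iff (b : ℕ) (l : ℝ) :
    (meanSqHessian x b - l • hessian x).PosSemidef ↔ ∀ v : Fin d → ℝ,
      l * (v ⬝ᵥ (hessian x *ᵥ v)) ≤ v ⬝ᵥ (meanSqHessian x b *ᵥ v) := by
  have h : (meanSqHessian x b - l • hessian x).IsHermitian :=
    (meanSqHessian_isHermitian x b).sub ((hessian_isHermitian x).smul (IsSelfAdjoint.all l))
  rw [Matrix.posSemidef_iff_dotProduct_mulVec, and_iff_right h]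
  simp [Matrix.sub_mulVec, Matrix.smul_mulVec]

theorem posSemidef_sub_meanSqHessian_iff (b : ℕ) (l : ℝ) :
    (l • hessian x - meanSqHessian x b).PosSemidef ↔ ∀ v : Fin d → ℝ,
      v ⬝ᵥ (meanSqHessian x b *ᵥ v) ≤ l * (v ⬝ᵥ (hessian x *ᵥ v)) := by
  have h : (l • hessian x - meanSqHessian x b).IsHermitian :=
    ((hessian_isHermitian x).smul (IsSelfAdjoint.all l)).sub (meanSqHessian_isHermitian x b)
  rw [Matrix.posSemidef_iff_dotProduct_mulVec, and_iff_right h]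
  simp [Matrix.sub_mulVec, Matrix.smul_mulVec]

theorem hessian_form_nonneg (v : Fin d → ℝ) : 0 ≤ v ⬝ᵥ (hessian x *ᵥ v) := by
  rw [dotProduct_hessian_mulVec]
  positivity

theorem meanSqHessian_form_nonneg (b : ℕ) (v : Fin d → ℝ) :
    0 ≤ v ⬝ᵥ (meanSqHessian x b *ᵥ v) := by
  rw [dotProduct_meanSqHessian_mulVec]
  positivity

/-- The quadratic form of `E_B[H_B²]` is dominated by a multiple of that of `H`. -/
theorem exists_meanSqHessian_form_le (b : ℕ) : ∃ K : ℝ, ∀ v : Fin d → ℝ,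
    v ⬝ᵥ (meanSqHessian x b *ᵥ v) ≤ K * (v ⬝ᵥ (hessian x *ᵥ v)) := by
  rcases Nat.eq_zero_or_pos n with rfl | hn
  · refine ⟨0, fun v => ?_⟩
    simp [dotProduct_meanSqHessian_mulVec, batchHessian_mulVec_apply, Finset.eq_empty_of_isEmpty]
  have hn' : (0 : ℝ) < n := by exact_mod_cast hn
  have key : ∀ (B : Batch n b) (v : Fin d → ℝ), ∑ j, (batchHessian x B.1 *ᵥ v) j ^ 2 ≤
      (1 / (B.1.card : ℝ)) ^ 2 * (∑ j, ∑ i ∈ B.1, x i j ^ 2) * ∑ i, (v ⬝ᵥ x i) ^ 2 := by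
    intro B v
    rw [mul_assoc, Finset.sum_mul, Finset.mul_sum]
    refine Finset.sum_le_sum fun j _ => ?_
    rw [batchHessian_mulVec_apply, mul_pow]
    refine mul_le_mul_of_nonneg_left ?_ (by positivity)
    refine (Finset.sum_mul_sq_le_sq_mul_sq _ _ _).trans ?_
    rw [mul_comm]
    refine mul_le_mul_of_nonneg_left ?_ (by positivity)
    exact Finset.sum_le_univ_sum_of_nonneg fun i => sq_nonneg _
  refine ⟨n * (1 / (Fintype.card (Batch n b) : ℝ) *
    ∑ B : Batch n b, (1 / (B.1.card : ℝ)) ^ 2 * (∑ j, ∑ i ∈ B.1, x i j ^ 2)), fun v => ?_⟩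
  rw [dotProduct_meanSqHessian_mulVec, dotProduct_hessian_mulVec]
  calc _ ≤ 1 / (Fintype.card (Batch n b) : ℝ) * ∑ B : Batch n b,
        (1 / (B.1.card : ℝ)) ^ 2 * (∑ j, ∑ i ∈ B.1, x i j ^ 2) * ∑ i, (v ⬝ᵥ x i) ^ 2 :=
        mul_le_mul_of_nonneg_left (Finset.sum_le_sum fun B _ => key B v) (by positivity)
    _ = _ := by
        rw [← Finset.sum_mul]
        field_simp

/-- If the form of `H` is positive at `v`, the ratio of the two forms at `v` bounds every admissible
`l`; where it vanishes, nonnegativity suffices. Thus the default value of `sSup` when `H = 0` is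
harmless. -/
theorem lamMin_mul_le (b : ℕ) (v : Fin d → ℝ) :
    lamMin x b * (v ⬝ᵥ (hessian x *ᵥ v)) ≤ v ⬝ᵥ (meanSqHessian x b *ᵥ v) := by
  rcases (hessian_form_nonneg x v).eq_or_lt with h | h
  · rw [← h, mul_zero]
    exact meanSqHessian_form_nonneg x b v
  · rw [← le_div_iff₀ h]
    refine csSup_le ⟨0, (posSemidef_meanSqHessian_sub_iff x b 0).2 fun w => ?_⟩ fun l hl => ?_
    · rw [zero_mul]
      exact meanSqHessian_form_nonneg x b w
    · rw [le_div_iff₀ h]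
      exact (posSemidef_meanSqHessian_sub_iff x b l).1 hl v

theorem le_lamMax_mul (b : ℕ) (v : Fin d → ℝ) :
    v ⬝ᵥ (meanSqHessian x b *ᵥ v) ≤ lamMax x b * (v ⬝ᵥ (hessian x *ᵥ v)) := by
  obtain ⟨K, hK⟩ := exists_meanSqHessian_form_le x b
  rcases (hessian_form_nonneg x v).eq_or_lt with h | h
  · have := hK v
    rwa [← h, mul_zero] at this ⊢
  · rw [← div_le_iff₀ h]
    refine le_csInf ⟨K, (posSemidef_sub_meanSqHessian_iff x b K).2 hK⟩ fun l hl => ?_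
    rw [div_le_iff₀ h]
    exact (posSemidef_sub_meanSqHessian_iff x b l).1 hl v

/-- Co-coercivity: `‖H_B v‖² ≤ L ⟨v, H_B v⟩`. -/
theorem IsSmoothness.sum_sq_le {L : ℝ} (h : IsSmoothness x b L) (B : Batch n b)
    (v : Fin d → ℝ) :
    ∑ j, (batchHessian x B.1 *ᵥ v) j ^ 2 ≤ L * (v ⬝ᵥ (batchHessian x B.1 *ᵥ v)) := by
  set w := batchHessian x B.1 *ᵥ v with hw
  set S := ∑ j, w j ^ 2 with hS
  have hS0 : 0 ≤ S := by positivity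
  have hc : (0 : ℝ) ≤ 1 / (B.1.card : ℝ) := by positivity
  have h1 : w ⬝ᵥ w = S := by simp [dotProduct, hS, sq]
  -- Cauchy–Schwarz for the semidefinite form of `H_B`, with `w = H_B v`; its left side is `‖w‖⁴`.
  have h2 : (w ⬝ᵥ (batchHessian x B.1 *ᵥ v)) ^ 2 ≤
      (w ⬝ᵥ (batchHessian x B.1 *ᵥ w)) * (v ⬝ᵥ (batchHessian x B.1 *ᵥ v)) := by
    simp only [dotProduct_batchHessian_mulVec]
    rw [mul_pow, mul_mul_mul_comm, ← sq]
    refine mul_le_mul_of_nonneg_left ?_ (by positivity)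
    simpa only [sq] using Finset.sum_mul_sq_le_sq_mul_sq B.1 (fun i => w ⬝ᵥ x i)
      (fun i => v ⬝ᵥ x i)
  rw [← hw, h1] at h2
  have h3 : w ⬝ᵥ (batchHessian x B.1 *ᵥ w) ≤ L * S := by
    have h4 : (w ⬝ᵥ (batchHessian x B.1 *ᵥ w)) ^ 2 ≤
        S * ∑ j, (batchHessian x B.1 *ᵥ w) j ^ 2 :=
      Finset.sum_mul_sq_le_sq_mul_sq Finset.univ w _
    have h5 : ∑ j, (batchHessian x B.1 *ᵥ w) j ^ 2 ≤ L ^ 2 * S := by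
      have h6 := h.l2 B w
      have h7 := pow_le_pow_left₀ (Real.sqrt_nonneg _) h6 2
      rwa [mul_pow, Real.sq_sqrt (by positivity), Real.sq_sqrt (by positivity)] at h7
    refine abs_le_of_sq_le_sq' ?_ (mul_nonneg h.pos.le hS0) |>.2
    nlinarith
  have h8 : 0 ≤ v ⬝ᵥ w := by
    rw [hw, dotProduct_batchHessian_mulVec]
    exact mul_nonneg hc (Finset.sum_nonneg fun i _ => mul_self_nonneg _)
  rcases hS0.eq_or_lt with h0 | h0
  · rw [← h0]
    exact mul_nonneg h.pos.le h8
  · have h9 : S * S ≤ S * (L * (v ⬝ᵥ w)) := by nlinarith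
    exact le_of_mul_le_mul_left h9 h0

end Quadratic

/-! ### Losses in terms of an interpolator -/

section Loss

variable {n d b : ℕ} {x : Fin n → Fin d → ℝ} {y : Fin n → ℝ}

theorem residual_eq {β' : Fin d → ℝ} (h : β' ∈ interpolators x y) (β : Fin d → ℝ) (i : Fin n) :
    β ⬝ᵥ x i - y i = (β - β') ⬝ᵥ x i := by
  rw [sub_dotProduct, h i]

theorem batchGrad_eq {β' : Fin d → ℝ} (h : β' ∈ interpolators x y) (B : Finset (Fin n))
    (β : Fin d → ℝ) : batchGrad x y B β = batchHessian x B *ᵥ (β - β') := by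
  ext j
  rw [batchHessian_mulVec_apply]
  simp only [batchGrad, residual_eq h]

theorem batchLoss_eq {β' : Fin d → ℝ} (h : β' ∈ interpolators x y) (B : Finset (Fin n))
    (β : Fin d → ℝ) :
    2 * batchLoss x y B β = (β - β') ⬝ᵥ (batchHessian x B *ᵥ (β - β')) := by
  rw [dotProduct_batchHessian_mulVec]
  simp only [batchLoss, residual_eq h, sq]
  ring

theorem loss_eq {β' : Fin d → ℝ} (h : β' ∈ interpolators x y) (β : Fin d → ℝ) :
    2 * loss x y β = (β - β') ⬝ᵥ (hessian x *ᵥ (β - β')) := by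
  rw [dotProduct_hessian_mulVec]
  simp only [loss, residual_eq h]
  ring

theorem batchLoss_nonneg (B : Finset (Fin n)) (β : Fin d → ℝ) : 0 ≤ batchLoss x y B β := by
  unfold batchLoss
  positivity

theorem loss_nonneg (β : Fin d → ℝ) : 0 ≤ loss x y β := by
  unfold loss
  positivity

theorem mem_interpolators_of_loss_eq_zero {β : Fin d → ℝ} (h : loss x y β = 0) :
    β ∈ interpolators x y := by
  intro i
  have hn : (0 : ℝ) < n := by exact_mod_cast i.pos
  have h1 : ∑ i, (β ⬝ᵥ x i - y i) ^ 2 = 0 := by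
    have h2 : (1 / (2 * (n : ℝ))) ≠ 0 := by positivity
    exact (mul_eq_zero.1 h).resolve_left h2
  have h3 := (Finset.sum_eq_zero_iff_of_nonneg fun i _ => sq_nonneg (β ⬝ᵥ x i - y i)).1 h1 i
    (Finset.mem_univ i)
  exact sub_eq_zero.1 (pow_eq_zero_iff two_ne_zero |>.1 h3)

theorem continuous_loss : Continuous (loss x y) := by
  unfold loss dotProduct
  fun_prop

theorem sum_batch {M : Type*} [AddCommMonoid M] (f : Finset (Fin n) → M) :
    ∑ B : Batch n b, f B.1 = ∑ s ∈ Finset.powersetCard b Finset.univ, f s :=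
  (Finset.sum_subtype _ (fun _ => Finset.mem_powersetCard_univ) f).symm

theorem card_batch : Fintype.card (Batch n b) = n.choose b := by
  have h := sum_batch (n := n) (b := b) (fun _ => 1)
  simpa using h

/-- The batch losses average to the loss. -/
theorem sum_batchLoss (hb : 1 ≤ b) (hbn : b ≤ n) (β : Fin d → ℝ) :
    ∑ B : Batch n b, batchLoss x y B.1 β = Fintype.card (Batch n b) * loss x y β := by
  rw [sum_batch (fun s => batchLoss x y s β), card_batch]
  have h1 : ∀ s ∈ Finset.powersetCard b (Finset.univ : Finset (Fin n)), batchLoss x y s β =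
      1 / (2 * (b : ℝ)) * ∑ i, if i ∈ s then (β ⬝ᵥ x i - y i) ^ 2 else 0 := by
    intro s hs
    rw [batchLoss, Finset.mem_powersetCard_univ.1 hs, ← Finset.sum_filter]
    simp
  rw [Finset.sum_congr rfl h1, ← Finset.mul_sum, Finset.sum_comm]
  -- Double counting: each sample lies in `(n - 1).choose (b - 1)` batches.
  have h2 : ∀ i : Fin n, (∑ s ∈ Finset.powersetCard b (Finset.univ : Finset (Fin n)),
      if i ∈ s then (β ⬝ᵥ x i - y i) ^ 2 else 0) =
      ((n - 1).choose (b - 1) : ℝ) * (β ⬝ᵥ x i - y i) ^ 2 := by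
    intro i
    have h := Finset.card_filter_powersetCard_subset {i} (Finset.univ : Finset (Fin n)) b
      (Finset.subset_univ _) (by simpa using hb)
    rw [← Finset.sum_filter, Finset.sum_const, nsmul_eq_mul]
    simp only [Finset.singleton_subset_iff, Finset.card_univ, Fintype.card_fin,
      Finset.card_singleton] at h
    rw [h]
  simp only [h2, ← Finset.mul_sum, loss]
  have h3 : (n : ℝ) * ((n - 1).choose (b - 1) : ℝ) = n.choose b * b := by
    obtain ⟨m, rfl⟩ : ∃ m, n = m + 1 := ⟨n - 1, by omega⟩
    obtain ⟨c, rfl⟩ : ∃ c, b = c + 1 := ⟨b - 1, by omega⟩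
    exact_mod_cast Nat.add_one_mul_choose_eq m c
  have hn : (0 : ℝ) < n := by exact_mod_cast (by omega : 0 < n)
  have hb' : (0 : ℝ) < b := by exact_mod_cast hb
  have h4 : (((n - 1).choose (b - 1) : ℕ) : ℝ) = n.choose b * b / n := by
    rw [eq_div_iff hn.ne', ← h3, mul_comm]
  rw [h4]
  field_simp

end Loss

/-! ### The potential of one coordinate -/

section Scalar

theorem neg_sub_two_mul_sq_le_log_one_sub {t : ℝ} (ht : |t| ≤ 1 / 2) :
    -t - 2 * t ^ 2 ≤ Real.log (1 - t) := by
  have h := abs_le.1 ht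
  have h1 : 0 < 1 - t := by linarith
  refine le_trans ?_ (Real.one_sub_inv_le_log_of_pos h1)
  have h2 : 1 - (1 - t)⁻¹ = -t - t ^ 2 / (1 - t) := by
    field_simp
    ring
  have h3 : t ^ 2 / (1 - t) ≤ 2 * t ^ 2 := by
    rw [div_le_iff₀ h1]
    nlinarith [sq_nonneg t]
  linarith

theorem log_one_sub_le {t : ℝ} (ht : |t| ≤ 1 / 2) : Real.log (1 - t) ≤ -t := by
  have h := Real.log_le_sub_one_of_pos (x := 1 - t) (by linarith [(abs_le.1 ht).2])
  linarith

/-- One coordinate of the potential: an unnormalised relative entropy between the positive and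
negative parts of `b` and `(p, m)`. -/
noncomputable def coordPotential (b p m : ℝ) : ℝ :=
  p + m - max b 0 * Real.log p - max (-b) 0 * Real.log m

theorem coordPotential_step {b p m t : ℝ} (hp : 0 < p) (hm : 0 < m) (ht : |t| ≤ 1 / 2) :
    coordPotential b ((1 - t) ^ 2 * p) ((1 + t) ^ 2 * m) = coordPotential b p m
      - 2 * t * (p - m) + t ^ 2 * (p + m) - 2 * (max b 0 * Real.log (1 - t)
      + max (-b) 0 * Real.log (1 + t)) := by
  have h := abs_le.1 ht
  have h1 : 0 < 1 - t := by linarith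
  have h2 : 0 < 1 + t := by linarith
  unfold coordPotential
  rw [Real.log_mul (by positivity) hp.ne', Real.log_mul (by positivity) hm.ne', Real.log_pow,
    Real.log_pow]
  push_cast
  ring

/-- The first-order parts of the logarithms turn `p - m` into `p - m - b`; their second-order errors
contribute `4|b|`. -/
theorem coordPotential_step_le {b p m t : ℝ} (hp : 0 < p) (hm : 0 < m) (ht : |t| ≤ 1 / 2) :
    coordPotential b ((1 - t) ^ 2 * p) ((1 + t) ^ 2 * m) ≤ coordPotential b p m
      - 2 * (t * (p - m - b)) + t ^ 2 * (p + m + 4 * |b|) := by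
  rw [coordPotential_step hp hm ht]
  have h1 := mul_le_mul_of_nonneg_left (neg_sub_two_mul_sq_le_log_one_sub ht)
    (le_max_right b 0)
  have h2 := mul_le_mul_of_nonneg_left
    (neg_sub_two_mul_sq_le_log_one_sub (t := -t) (by rwa [abs_neg])) (le_max_right (-b) 0)
  rw [sub_neg_eq_add] at h2
  have h3 := max_zero_sub_max_neg_zero_eq_self b
  have h4 := max_zero_add_max_neg_zero_eq_abs_self b
  have h6 : t * (p - m - b) = t * (p - m) - t * (max b 0 - max (-b) 0) := by rw [h3]; ring
  rw [← h4, h6]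
  nlinarith

theorem le_coordPotential_step {b p m t : ℝ} (hp : 0 < p) (hm : 0 < m) (ht : |t| ≤ 1 / 2) :
    coordPotential b p m - 2 * (t * (p - m - b)) ≤
      coordPotential b ((1 - t) ^ 2 * p) ((1 + t) ^ 2 * m) := by
  rw [coordPotential_step hp hm ht]
  have h1 := mul_le_mul_of_nonneg_left (log_one_sub_le ht) (le_max_right b 0)
  have h2 := mul_le_mul_of_nonneg_left
    (log_one_sub_le (t := -t) (by rwa [abs_neg])) (le_max_right (-b) 0)
  rw [sub_neg_eq_add] at h2
  have h3 := max_zero_sub_max_neg_zero_eq_self b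
  have h5 : 0 ≤ t ^ 2 * (p + m) := by positivity
  have h6 : t * (p - m - b) = t * (p - m) - t * (max b 0 - max (-b) 0) := by rw [h3]; ring
  rw [h6]
  nlinarith

/-- `(p + m)² = (p - m)² + 4pm`. -/
theorem add_le_abs_sub_add {p m a : ℝ} (ha : 0 ≤ a) (h : 4 * (p * m) ≤ a ^ 2) :
    p + m ≤ |p - m| + a := by
  refine abs_le_of_sq_le_sq' ?_ (by positivity) |>.2
  nlinarith [sq_abs (p - m), mul_nonneg (abs_nonneg (p - m)) ha]

/-- The mass on the side of the sign of `b` is at least `|b|`, and only its logarithm has nonzero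
weight. -/
theorem coordPotential_le {b p m a : ℝ} (hb : b = p - m) (hp : 0 ≤ p) (hm : 0 ≤ m) (ha : 0 ≤ a)
    (h : 4 * (p * m) ≤ a ^ 2) : coordPotential b p m ≤ |b| + a - |b| * Real.log |b| := by
  have h1 := add_le_abs_sub_add ha h
  rw [← hb] at h1
  unfold coordPotential
  rcases lt_trichotomy b 0 with hb0 | hb0 | hb0
  · rw [max_eq_right hb0.le, max_eq_left (by linarith), abs_of_neg hb0] at *
    have := Real.log_le_log (x := -b) (y := m) (by linarith) (by linarith)
    nlinarith
  · subst hb0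
    simp at *
    exact h1
  · rw [max_eq_left hb0.le, max_eq_right (by linarith), abs_of_pos hb0] at *
    have := Real.log_le_log (x := b) (y := p) (by linarith) (by linarith)
    nlinarith

/-- A limit mass may be zero, where `Real.log` is discontinuous, but `b = p - m` makes the weight of
that logarithm zero. -/
theorem tendsto_coordPotential {ι : Type*} {l : Filter ι} {P M : ι → ℝ} {b p m : ℝ}
    (hb : b = p - m) (hp : 0 ≤ p) (hm : 0 ≤ m) (hP : Filter.Tendsto P l (nhds p))
    (hM : Filter.Tendsto M l (nhds m)) :
    Filter.Tendsto (fun i => coordPotential b (P i) (M i)) l (nhds (coordPotential b p m)) := by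
  have key : ∀ {c r : ℝ} {R : ι → ℝ}, c ≤ r → 0 ≤ r → Filter.Tendsto R l (nhds r) →
      Filter.Tendsto (fun i => max c 0 * Real.log (R i)) l (nhds (max c 0 * Real.log r)) := by
    intro c r R hc hr hR
    rcases le_or_gt c 0 with h | h
    · simp only [max_eq_right h, zero_mul]
      exact tendsto_const_nhds
    · exact (hR.log (by linarith)).const_mul _
  unfold coordPotential
  exact ((hP.add hM).sub (key (by linarith) hp hP)).sub (key (by linarith) hm hM)

end Scalar

/-! ### The relative entropy potential -/

section Potential

variable {d : ℕ}

/-- The unnormalised relative entropy between the positive and negative parts of `β'` and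
`(p, m)`. -/
noncomputable def potential (β' p m : Fin d → ℝ) : ℝ :=
  ∑ j, coordPotential (β' j) (p j) (m j)

theorem l1Norm_nonneg (β : Fin d → ℝ) : 0 ≤ l1Norm β :=
  Finset.sum_nonneg fun _ _ => abs_nonneg _

theorem abs_le_l1Norm (β : Fin d → ℝ) (j : Fin d) : |β j| ≤ l1Norm β :=
  Finset.single_le_sum (f := fun j => |β j|) (fun _ _ => abs_nonneg _) (Finset.mem_univ j)

theorem norm_le_l1Norm (β : Fin d → ℝ) : ‖β‖ ≤ l1Norm β :=
  (pi_norm_le_iff_of_nonneg (l1Norm_nonneg β)).2 fun j => abs_le_l1Norm β j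

theorem l1Norm_pos {β : Fin d → ℝ} (h : β ≠ 0) : 0 < l1Norm β :=
  (norm_pos_iff.2 h).trans_le (norm_le_l1Norm β)

/-- Each single mass is at most the total mass, so every logarithm may be replaced by that of the
total. -/
theorem sub_mul_log_le_potential (β' : Fin d → ℝ) {p m : Fin d → ℝ} (hp : ∀ j, 0 < p j)
    (hm : ∀ j, 0 < m j) :
    ∑ j, (p j + m j) - l1Norm β' * Real.log (∑ j, (p j + m j)) ≤ potential β' p m := by
  set S := ∑ j, (p j + m j) with hS
  have hle : ∀ j, p j + m j ≤ S := fun j =>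
    Finset.single_le_sum (f := fun j => p j + m j) (fun i _ => (add_pos (hp i) (hm i)).le)
      (Finset.mem_univ j)
  rw [hS, l1Norm, Finset.sum_mul, ← Finset.sum_sub_distrib, potential]
  refine Finset.sum_le_sum fun j _ => ?_
  rw [← hS, ← max_zero_add_max_neg_zero_eq_abs_self, coordPotential]
  have h1 := mul_le_mul_of_nonneg_left
    (Real.log_le_log (hp j) (by linarith [hle j, hm j] : p j ≤ S)) (le_max_right (β' j) 0)
  have h2 := mul_le_mul_of_nonneg_left
    (Real.log_le_log (hm j) (by linarith [hle j, hp j] : m j ≤ S)) (le_max_right (-β' j) 0)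
  linarith

theorem potential_const (β' : Fin d → ℝ) (a : ℝ) :
    potential β' (fun _ => a) (fun _ => a) = d * (2 * a) - l1Norm β' * Real.log a := by
  have h : ∀ j, coordPotential (β' j) a a = 2 * a - |β' j| * Real.log a := by
    intro j
    rw [← max_zero_add_max_neg_zero_eq_abs_self, coordPotential]
    ring
  simp [potential, h, Finset.sum_sub_distrib, ← Finset.sum_mul, l1Norm]

/-- Jensen's inequality for `t ↦ t log t`. -/
theorem l1Norm_mul_log_le (b : Fin d → ℝ) (h : 0 < l1Norm b) :
    l1Norm b * Real.log (l1Norm b / d) ≤ ∑ j, |b j| * Real.log |b j| := by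
  have hd : (0 : ℝ) < d := by
    rcases Nat.eq_zero_or_pos d with rfl | hd
    · simp [l1Norm] at h
    · exact_mod_cast hd
  set A := l1Norm b with hA
  have h1 : ∀ j, |b j| * (Real.log (A / d) - Real.log |b j|) ≤ A / d - |b j| := by
    intro j
    rcases (abs_nonneg (b j)).eq_or_lt with h0 | h0
    · rw [← h0]
      simp only [zero_mul, sub_zero]
      positivity
    · rw [← Real.log_div (by positivity) h0.ne']
      have h2 := Real.log_le_sub_one_of_pos (x := A / d / |b j|) (by positivity)
      calc _ ≤ |b j| * (A / d / |b j| - 1) := mul_le_mul_of_nonneg_left h2 h0.le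
        _ = _ := by field_simp
  have h2 := Finset.sum_le_sum fun j (_ : j ∈ Finset.univ) => h1 j
  simp only [mul_sub, Finset.sum_sub_distrib, ← Finset.sum_mul, Finset.sum_const,
    Finset.card_univ, Fintype.card_fin, nsmul_eq_mul] at h2
  rw [mul_div_cancel₀ _ hd.ne'] at h2
  change A * _ - _ ≤ A - A at h2
  linarith

end Potential

/-! ### Evolution of masses and potential along SGD -/

section Trajectory

variable {n d b : ℕ} {x : Fin n → Fin d → ℝ} {y : Fin n → ℝ} {α γ L R : ℝ}
  {B : ℕ → Batch n b}

variable (x y α γ B) in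
/-- The squares `((u + v) / 2)²`. -/
noncomputable def plusMass (k : ℕ) (j : Fin d) : ℝ :=
  (((neurons x y α γ B k).1 j + (neurons x y α γ B k).2 j) / 2) ^ 2

variable (x y α γ B) in
/-- The squares `((u - v) / 2)²`. -/
noncomputable def minusMass (k : ℕ) (j : Fin d) : ℝ :=
  (((neurons x y α γ B k).1 j - (neurons x y α γ B k).2 j) / 2) ^ 2

theorem plusMass_zero : plusMass x y α γ B 0 = fun _ => α ^ 2 / 2 := by
  ext j
  simp [plusMass, neurons, div_pow, mul_pow]
  ring

theorem minusMass_zero : minusMass x y α γ B 0 = fun _ => α ^ 2 / 2 := by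
  ext j
  simp [minusMass, neurons, div_pow, mul_pow]
  ring

theorem plusMass_succ (k : ℕ) (j : Fin d) : plusMass x y α γ B (k + 1) j =
    (1 - scaledGrad x y α γ B k j) ^ 2 * plusMass x y α γ B k j := by
  simp [plusMass, neurons, neuronGrad, scaledGrad, iterate]
  ring

theorem minusMass_succ (k : ℕ) (j : Fin d) : minusMass x y α γ B (k + 1) j =
    (1 + scaledGrad x y α γ B k j) ^ 2 * minusMass x y α γ B k j := by
  simp [minusMass, neurons, neuronGrad, scaledGrad, iterate]
  ring

theorem iterate_eq_sub (k : ℕ) (j : Fin d) :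
    iterate x y α γ B k j = plusMass x y α γ B k j - minusMass x y α γ B k j := by
  simp [plusMass, minusMass, iterate]
  ring

theorem abs_le_of_norm_le {t : Fin d → ℝ} {c : ℝ} (h : ‖t‖ ≤ c) (j : Fin d) : |t j| ≤ c :=
  (norm_le_pi_norm t j).trans h

/-- A step multiplies the product of the masses by `(1 - t²)² ≤ 1`, and initially both masses are
`α² / 2`. -/
theorem mass_bounds (hα : 0 < α) (k : ℕ) (h : ∀ i < k, ‖scaledGrad x y α γ B i‖ ≤ 1 / 2)
    (j : Fin d) : 0 < plusMass x y α γ B k j ∧ 0 < minusMass x y α γ B k j ∧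
      4 * (plusMass x y α γ B k j * minusMass x y α γ B k j) ≤ (α ^ 2) ^ 2 := by
  induction k with
  | zero =>
    rw [plusMass_zero, minusMass_zero]
    refine ⟨by positivity, by positivity, le_of_eq (by ring)⟩
  | succ k ih =>
    obtain ⟨h1, h2, h3⟩ := ih fun i hi => h i (by omega)
    have ht := abs_le.1 (abs_le_of_norm_le (h k (by omega)) j)
    rw [plusMass_succ, minusMass_succ]
    set t := scaledGrad x y α γ B k j
    have h4 : 0 < 1 - t := by linarith
    have h5 : 0 < 1 + t := by linarith
    refine ⟨by positivity, by positivity, le_trans ?_ h3⟩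
    have h6 : (1 - t) ^ 2 * (1 + t) ^ 2 ≤ 1 := by
      rw [← mul_pow]
      exact pow_le_one₀ (by positivity) (by nlinarith [sq_nonneg t])
    have h7 := mul_le_mul_of_nonneg_right h6 (mul_pos h1 h2).le
    nlinarith

theorem mass_add_le (hα : 0 < α) (k : ℕ) (h : ∀ i < k, ‖scaledGrad x y α γ B i‖ ≤ 1 / 2)
    (j : Fin d) : plusMass x y α γ B k j + minusMass x y α γ B k j ≤
      |iterate x y α γ B k j| + α ^ 2 := by
  rw [iterate_eq_sub]
  exact add_le_abs_sub_add (by positivity) (mass_bounds hα k h j).2.2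

variable (x y α γ B) in
/-- The potential of the `k`-th iterate. -/
noncomputable def iteratePotential (β' : Fin d → ℝ) (k : ℕ) : ℝ :=
  potential β' (plusMass x y α γ B k) (minusMass x y α γ B k)

theorem sum_scaledGrad_mul {β' : Fin d → ℝ} (h' : β' ∈ interpolators x y) (k : ℕ) :
    ∑ j, scaledGrad x y α γ B k j * (iterate x y α γ B k j - β' j) =
      2 * γ * batchLoss x y (B k).1 (iterate x y α γ B k) := by
  rw [mul_right_comm, batchLoss_eq h', mul_comm, dotProduct, Finset.mul_sum]
  refine Finset.sum_congr rfl fun j _ => ?_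
  rw [scaledGrad, batchGrad_eq h']
  simp only [Pi.smul_apply, Pi.sub_apply, smul_eq_mul]
  ring

theorem sum_scaledGrad_sq_le {β' : Fin d → ℝ} (h' : β' ∈ interpolators x y)
    (hL : IsSmoothness x b L) (k : ℕ) :
    ∑ j, scaledGrad x y α γ B k j ^ 2 ≤
      γ ^ 2 * (L * (2 * batchLoss x y (B k).1 (iterate x y α γ B k))) := by
  rw [batchLoss_eq h']
  refine le_trans (le_of_eq ?_) (mul_le_mul_of_nonneg_left
    (hL.sum_sq_le x (B k) (iterate x y α γ B k - β')) (sq_nonneg γ))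
  rw [Finset.mul_sum]
  refine Finset.sum_congr rfl fun j _ => ?_
  rw [scaledGrad, batchGrad_eq h']
  simp only [Pi.smul_apply, smul_eq_mul]
  ring

theorem norm_scaledGrad_le {β' : Fin d → ℝ} (h' : β' ∈ interpolators x y)
    (hL : IsSmoothness x b L) (hγ : 0 < γ) (hR : ‖β'‖ ≤ R) (hγR : γ * (R * L) ≤ 1 / 8) (k : ℕ)
    (hk : ‖iterate x y α γ B k‖ ≤ R) : ‖scaledGrad x y α γ B k‖ ≤ 1 / 2 := by
  rw [scaledGrad, batchGrad_eq h', norm_smul, Real.norm_of_nonneg hγ.le]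
  have h1 := hL.linf (B k) (iterate x y α γ B k - β')
  have h2 : ‖iterate x y α γ B k - β'‖ ≤ 2 * R := (norm_sub_le _ _).trans (by linarith)
  have h3 := mul_le_mul_of_nonneg_left h2 hL.pos.le
  have h4 := mul_le_mul_of_nonneg_left (h1.trans h3) hγ.le
  linarith

theorem iteratePotential_succ_le {β' : Fin d → ℝ} (h' : β' ∈ interpolators x y)
    (hL : IsSmoothness x b L) (hα : 0 < α) (hγ : 0 < γ) (hR : ‖β'‖ ≤ R) (hαR : α ^ 2 ≤ R)
    (hγR : γ * (R * L) ≤ 1 / 8) (k : ℕ) (hk : ∀ i ≤ k, ‖iterate x y α γ B i‖ ≤ R) :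
    iteratePotential x y α γ B β' (k + 1) ≤ iteratePotential x y α γ B β' k -
      2 * γ * batchLoss x y (B k).1 (iterate x y α γ B k) := by
  have hg : ∀ i ≤ k, ‖scaledGrad x y α γ B i‖ ≤ 1 / 2 := fun i hi =>
    norm_scaledGrad_le h' hL hγ hR hγR i (hk i hi)
  have h1 : ∀ j, coordPotential (β' j) (plusMass x y α γ B (k + 1) j)
      (minusMass x y α γ B (k + 1) j) ≤
      coordPotential (β' j) (plusMass x y α γ B k j) (minusMass x y α γ B k j) -
      2 * (scaledGrad x y α γ B k j * (iterate x y α γ B k j - β' j)) +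
      scaledGrad x y α γ B k j ^ 2 * (6 * R) := by
    intro j
    obtain ⟨hp, hm, -⟩ := mass_bounds hα k (fun i hi => hg i hi.le) j
    rw [plusMass_succ, minusMass_succ]
    refine (coordPotential_step_le hp hm (abs_le_of_norm_le (hg k le_rfl) j)).trans ?_
    rw [iterate_eq_sub]
    have h2 := mass_add_le hα k (fun i hi => hg i hi.le) j
    have h3 := abs_le_of_norm_le (hk k le_rfl) j
    have h4 := abs_le_of_norm_le hR j
    gcongr
    linarith
  have h2 := Finset.sum_le_sum fun j (_ : j ∈ Finset.univ) => h1 j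
  rw [Finset.sum_add_distrib, Finset.sum_sub_distrib, ← Finset.mul_sum, ← Finset.sum_mul,
    sum_scaledGrad_mul h'] at h2
  change iteratePotential x y α γ B β' (k + 1) ≤ iteratePotential x y α γ B β' k - _ + _ at h2
  have hR0 : 0 ≤ R := (norm_nonneg _).trans hR
  -- The error is at most `12 γRL · γ` times the batch loss; `γRL ≤ 1/8` makes this `3/2 γ`, less
  -- than half of the decrease `4γ`.
  have h3 := mul_le_mul_of_nonneg_right
    (sum_scaledGrad_sq_le (α := α) (γ := γ) (B := B) h' hL k)
    (by positivity : 0 ≤ 6 * R)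
  have h4 : 0 ≤ γ * batchLoss x y (B k).1 (iterate x y α γ B k) :=
    mul_nonneg hγ.le (batchLoss_nonneg _ _)
  have h5 := mul_le_mul_of_nonneg_right hγR h4
  nlinarith

theorem iteratePotential_le {β' : Fin d → ℝ} (h' : β' ∈ interpolators x y)
    (hL : IsSmoothness x b L) (hα : 0 < α) (hγ : 0 < γ) (hR : ‖β'‖ ≤ R) (hαR : α ^ 2 ≤ R)
    (hγR : γ * (R * L) ≤ 1 / 8) (k : ℕ) (hk : ∀ i < k, ‖iterate x y α γ B i‖ ≤ R) :
    iteratePotential x y α γ B β' k +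
      2 * γ * ∑ i ∈ Finset.range k, batchLoss x y (B i).1 (iterate x y α γ B i) ≤
      d * α ^ 2 - l1Norm β' * Real.log (α ^ 2 / 2) := by
  induction k with
  | zero =>
    rw [iteratePotential, plusMass_zero, minusMass_zero, potential_const]
    simp only [Finset.range_zero, Finset.sum_empty, mul_zero, add_zero]
    exact le_of_eq (by ring)
  | succ k ih =>
    have h1 := ih fun i hi => hk i (by omega)
    have h2 := iteratePotential_succ_le h' hL hα hγ hR hαR hγR k fun i hi => hk i (by omega)
    rw [Finset.sum_range_succ]
    linarith

theorem le_iteratePotential {β' : Fin d → ℝ} (h' : β' ∈ interpolators x y) (hα : 0 < α)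
    (hg : ∀ k, ‖scaledGrad x y α γ B k‖ ≤ 1 / 2) (k : ℕ) :
    d * α ^ 2 - l1Norm β' * Real.log (α ^ 2 / 2) -
      4 * γ * ∑ i ∈ Finset.range k, batchLoss x y (B i).1 (iterate x y α γ B i) ≤
      iteratePotential x y α γ B β' k := by
  induction k with
  | zero =>
    rw [iteratePotential, plusMass_zero, minusMass_zero, potential_const]
    simp only [Finset.range_zero, Finset.sum_empty, mul_zero, sub_zero]
    exact le_of_eq (by ring)
  | succ k ih =>
    have h1 : ∀ j, coordPotential (β' j) (plusMass x y α γ B k j) (minusMass x y α γ B k j) -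
        2 * (scaledGrad x y α γ B k j * (iterate x y α γ B k j - β' j)) ≤
        coordPotential (β' j) (plusMass x y α γ B (k + 1) j) (minusMass x y α γ B (k + 1) j) := by
      intro j
      obtain ⟨hp, hm, -⟩ := mass_bounds hα k (fun i _ => hg i) j
      rw [plusMass_succ, minusMass_succ, iterate_eq_sub]
      exact le_coordPotential_step hp hm (abs_le_of_norm_le (hg k) j)
    have h2 := Finset.sum_le_sum fun j (_ : j ∈ Finset.univ) => h1 j
    rw [Finset.sum_sub_distrib, ← Finset.mul_sum, sum_scaledGrad_mul h'] at h2
    change iteratePotential x y α γ B β' k - _ ≤ iteratePotential x y α γ B β' (k + 1) at h2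
    rw [Finset.sum_range_succ]
    linarith

end Trajectory

/-! ### Pathwise bounds for small initialisation -/

section SmallInitialisation

variable {n d b : ℕ} {x : Fin n → Fin d → ℝ} {y : Fin n → ℝ} {α γ L R : ℝ}
  {B : ℕ → Batch n b} {β' : Fin d → ℝ}

theorem le_three_mul_log {A : ℝ} (hα : 0 < α) (hA : 6 * α ^ 2 ≤ A) :
    A ≤ 3 * A * Real.log (1 + A / α ^ 2) := by
  have hα2 : 0 < α ^ 2 := by positivity
  have hA0 : 0 < A := by linarith
  have h6 : 6 ≤ A / α ^ 2 := by rwa [le_div_iff₀ hα2]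
  have h1 := Real.one_sub_inv_le_log_of_pos (x := 1 + A / α ^ 2) (by linarith)
  have h2 : (1 + A / α ^ 2)⁻¹ ≤ 2⁻¹ := inv_anti₀ (by norm_num) (by linarith)
  nlinarith

theorem sum_mass_le {A : ℝ} (hα : 0 < α) (hA : 6 * α ^ 2 ≤ A) (hdA : d * α ^ 2 ≤ A) {S : ℝ}
    (hS : 0 ≤ S)
    (h : S - A * Real.log S ≤ d * α ^ 2 - A * Real.log (α ^ 2 / 2)) :
    S ≤ 3 * A * Real.log (1 + A / α ^ 2) := by
  have hα2 : 0 < α ^ 2 := by positivity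
  have hA0 : 0 < A := by linarith
  have h6 : 6 ≤ A / α ^ 2 := by rwa [le_div_iff₀ hα2]
  rcases hS.eq_or_lt with h0 | h0
  · rw [← h0]
    exact hA0.le.trans (le_three_mul_log hα hA)
  -- Tangent of the logarithm at `3A`: `A log S` then costs only `S / 3`, which the left side
  -- absorbs.
  have h1 := Real.log_le_sub_one_of_pos (x := S / (3 * A)) (by positivity)
  rw [Real.log_div h0.ne' (by positivity)] at h1
  have h2 := mul_le_mul_of_nonneg_left h1 hA0.le
  have h3 : A * (S / (3 * A) - 1) = S / 3 - A := by field_simp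
  rw [h3] at h2
  have h4 : Real.log (3 * A) - Real.log (α ^ 2 / 2) ≤ 2 * Real.log (1 + A / α ^ 2) := by
    rw [← Real.log_div (by positivity) (by positivity), ← Real.log_rpow (by positivity)]
    refine Real.log_le_log (by positivity) ?_
    have h5 : 3 * A / (α ^ 2 / 2) = 6 * (A / α ^ 2) := by field_simp; ring
    rw [h5, Real.rpow_two]
    -- With `z = A / α² ≥ 6` one has `6z ≤ z² ≤ (1 + z)²`.
    nlinarith
  have h5 := mul_le_mul_of_nonneg_left h4 hA0.le
  nlinarith

/-- The iterates stay bounded by `3 ‖β'‖₁ ln(1 + ‖β'‖₁ / α²)`. -/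
theorem norm_iterate_le (h' : β' ∈ interpolators x y) (hL : IsSmoothness x b L) (hα : 0 < α)
    (hγ : 0 < γ) (hA : 6 * α ^ 2 ≤ l1Norm β') (hdA : d * α ^ 2 ≤ l1Norm β')
    (hRA : R = 3 * l1Norm β' * Real.log (1 + l1Norm β' / α ^ 2))
    (hγR : γ * (R * L) ≤ 1 / 8) (k : ℕ) : ‖iterate x y α γ B k‖ ≤ R := by
  have hAR : l1Norm β' ≤ R := hRA ▸ le_three_mul_log hα hA
  have hR : ‖β'‖ ≤ R := (norm_le_l1Norm β').trans hAR
  have hR0 : 0 ≤ R := (norm_nonneg _).trans hR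
  have hαR : α ^ 2 ≤ R := by nlinarith [sq_nonneg α]
  induction k using Nat.strong_induction_on with
  | _ k ih =>
    have h1 := iteratePotential_le h' hL hα hγ hR hαR hγR k ih
    have hmass := mass_bounds hα k fun i hi => norm_scaledGrad_le h' hL hγ hR hγR i (ih i hi)
    have h2 := sub_mul_log_le_potential β' (fun j => (hmass j).1) fun j => (hmass j).2.1
    have h3 : 0 ≤ 2 * γ * ∑ i ∈ Finset.range k, batchLoss x y (B i).1 (iterate x y α γ B i) :=
      mul_nonneg (by positivity) (Finset.sum_nonneg fun i _ => batchLoss_nonneg _ _)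
    have h4 : ∀ j ∈ Finset.univ, 0 ≤ plusMass x y α γ B k j + minusMass x y α γ B k j :=
      fun j _ => (add_pos (hmass j).1 (hmass j).2.1).le
    have h5 := sum_mass_le hα hA hdA (Finset.sum_nonneg h4)
      (h2.trans (by rw [iteratePotential] at h1; linarith))
    rw [← hRA] at h5
    refine (pi_norm_le_iff_of_nonneg hR0).2 fun j => le_trans ?_ h5
    refine le_trans ?_ (Finset.single_le_sum h4 (Finset.mem_univ j))
    rw [iterate_eq_sub, Real.norm_eq_abs, abs_le]
    constructor <;> linarith [(hmass j).1, (hmass j).2.1]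

/-- The accumulated batch losses are at most of order `ln(1/α) ‖β'‖₁`. -/
theorem sum_batchLoss_le (h' : β' ∈ interpolators x y) (hL : IsSmoothness x b L) (hα : 0 < α)
    (hγ : 0 < γ) (hA : 0 < l1Norm β') (hdA : d * α ^ 2 ≤ l1Norm β')
    (hαA : 2 * l1Norm β' * α ≤ 1) (hR : ‖β'‖ ≤ R) (hαR : α ^ 2 ≤ R)
    (hγR : γ * (R * L) ≤ 1 / 8) (hk : ∀ i, ‖iterate x y α γ B i‖ ≤ R) (k : ℕ) :
    2 * γ * ∑ i ∈ Finset.range k, batchLoss x y (B i).1 (iterate x y α γ B i) ≤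
      3 * (l1Norm β' * Real.log (1 / α)) := by
  have h1 := iteratePotential_le h' hL hα hγ hR hαR hγR k fun i _ => hk i
  have hmass := mass_bounds hα k fun i _ => norm_scaledGrad_le h' hL hγ hR hγR i (hk i)
  have h2 := sub_mul_log_le_potential β' (fun j => (hmass j).1) fun j => (hmass j).2.1
  set A := l1Norm β' with hAdef
  set S := ∑ j, (plusMass x y α γ B k j + minusMass x y α γ B k j) with hSdef
  have hd : Nonempty (Fin d) := by
    by_contra hd
    rw [not_nonempty_iff] at hd
    simp [hAdef, l1Norm] at hA
  have hS : 0 < S := Finset.sum_pos (fun j _ => add_pos (hmass j).1 (hmass j).2.1)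
    Finset.univ_nonempty
  -- `S ↦ S - A log S` is minimal at `S = A`.
  have h3 : A - A * Real.log A ≤ S - A * Real.log S := by
    have h4 := Real.log_le_sub_one_of_pos (x := S / A) (by positivity)
    rw [Real.log_div hS.ne' hA.ne'] at h4
    have h5 := mul_le_mul_of_nonneg_left h4 hA.le
    have h6 : A * (S / A - 1) = S - A := by field_simp
    linarith
  have h4 : Real.log (2 * A) ≤ Real.log (1 / α) :=
    Real.log_le_log (by positivity) (by rwa [le_div_iff₀ hα])
  rw [Real.log_mul two_ne_zero hA.ne'] at h4
  rw [Real.log_div (by positivity) two_ne_zero, Real.log_pow] at h1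
  have h5 : Real.log (1 / α) = -Real.log α := by rw [one_div, Real.log_inv]
  rw [iteratePotential] at h1
  push_cast at h1
  rw [h5] at h4 ⊢
  have h6 := mul_le_mul_of_nonneg_left h4 hA.le
  nlinarith

/-- Along trajectories whose loss tends to zero, the accumulated batch losses are at least of
order `ln(1/α) ‖β'‖₁`, for `β'` of minimal `ℓ¹` norm among the interpolators. -/
theorem le_of_forall_sum_batchLoss_le (h' : IsMinL1Interpolator x y β') (hα : 0 < α)
    (hα1 : α ≤ 1) (hA : 0 < l1Norm β') (hdA : 2 * d * α ≤ l1Norm β')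
    (hg : ∀ k, ‖scaledGrad x y α γ B k‖ ≤ 1 / 2) (hk : ∀ i, ‖iterate x y α γ B i‖ ≤ R)
    (hloss : Filter.Tendsto (fun k => loss x y (iterate x y α γ B k)) Filter.atTop (nhds 0))
    {C : ℝ}
    (hC : ∀ k, 4 * γ * ∑ i ∈ Finset.range k, batchLoss x y (B i).1 (iterate x y α γ B i) ≤ C) :
    l1Norm β' * Real.log (1 / α) ≤ C := by
  have hmass := fun k => mass_bounds hα k (fun i _ => hg i)
  have hbd : ∀ k, (plusMass x y α γ B k, minusMass x y α γ B k) ∈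
      Metric.closedBall (0 : (Fin d → ℝ) × (Fin d → ℝ)) (R + α ^ 2) := by
    intro k
    have hR0 : 0 ≤ R + α ^ 2 := add_nonneg ((norm_nonneg _).trans (hk 0)) (sq_nonneg α)
    rw [mem_closedBall_zero_iff, norm_prod_le_iff]
    constructor <;> refine (pi_norm_le_iff_of_nonneg hR0).2 fun j => ?_
    all_goals
      have h1 := mass_add_le hα k (fun i _ => hg i) j
      have h2 := abs_le_of_norm_le (hk k) j
      have h3 := hmass k j
      rw [Real.norm_eq_abs, abs_le]
      constructor <;> linarith
  -- Both masses, not only their difference, must converge along the subsequence, since the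
  -- potential depends on the pair.
  obtain ⟨⟨p, m⟩, -, φ, hφ, hlim⟩ := (isCompact_closedBall _ _).tendsto_subseq hbd
  have hp : ∀ j, Filter.Tendsto (fun k => plusMass x y α γ B (φ k) j) Filter.atTop
      (nhds (p j)) := fun j => (tendsto_pi_nhds.1 hlim.fst_nhds) j
  have hm : ∀ j, Filter.Tendsto (fun k => minusMass x y α γ B (φ k) j) Filter.atTop
      (nhds (m j)) := fun j => (tendsto_pi_nhds.1 hlim.snd_nhds) j
  have hp0 : ∀ j, 0 ≤ p j := fun j => ge_of_tendsto' (hp j) fun k => (hmass _ j).1.le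
  have hm0 : ∀ j, 0 ≤ m j := fun j => ge_of_tendsto' (hm j) fun k => (hmass _ j).2.1.le
  have hpm : ∀ j, 4 * (p j * m j) ≤ (α ^ 2) ^ 2 := fun j =>
    le_of_tendsto' (((hp j).mul (hm j)).const_mul 4) fun k => (hmass _ j).2.2
  have hβ : Filter.Tendsto (fun k => iterate x y α γ B (φ k)) Filter.atTop (nhds (p - m)) := by
    rw [tendsto_pi_nhds]
    intro j
    simp only [iterate_eq_sub]
    exact (hp j).sub (hm j)
  have hb : p - m ∈ interpolators x y := by
    refine mem_interpolators_of_loss_eq_zero ?_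
    exact tendsto_nhds_unique ((continuous_loss.tendsto _).comp hβ)
      (hloss.comp hφ.tendsto_atTop)
  have hpot : Filter.Tendsto (fun k => iteratePotential x y α γ B (p - m) (φ k)) Filter.atTop
      (nhds (potential (p - m) p m)) :=
    tendsto_finsetSum _ fun j _ =>
      tendsto_coordPotential (Pi.sub_apply p m j) (hp0 j) (hm0 j) (hp j) (hm j)
  have h1 : d * α ^ 2 - l1Norm (p - m) * Real.log (α ^ 2 / 2) - C ≤ potential (p - m) p m :=
    ge_of_tendsto' hpot fun k => by
      have := le_iteratePotential hb hα hg (φ k)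
      linarith [hC (φ k)]
  have h2 : potential (p - m) p m ≤
      ∑ j, (|(p - m) j| + α ^ 2 - |(p - m) j| * Real.log |(p - m) j|) :=
    Finset.sum_le_sum fun j _ =>
      coordPotential_le (Pi.sub_apply p m j) (hp0 j) (hm0 j) (sq_nonneg α) (hpm j)
  rw [Finset.sum_sub_distrib, Finset.sum_add_distrib] at h2
  simp only [Finset.sum_const, Finset.card_univ, Fintype.card_fin, nsmul_eq_mul] at h2
  change _ ≤ l1Norm (p - m) + _ - _ at h2
  have hAb := h'.2 _ hb
  set a := l1Norm (p - m)
  have ha : 0 < a := hA.trans_le hAb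
  have h3 := l1Norm_mul_log_le (p - m) ha
  change a * Real.log (a / d) ≤ _ at h3
  have hd : (0 : ℝ) < d := by
    rcases Nat.eq_zero_or_pos d with rfl | hd
    · simp [l1Norm] at hA
    · exact_mod_cast hd
  have hl0 : 0 ≤ Real.log (1 / α) := Real.log_nonneg (by rwa [le_div_iff₀ hα, one_mul])
  have h4 : Real.log 2 ≤ Real.log (1 / α) + Real.log (a / d) := by
    rw [← Real.log_mul (by positivity) (by positivity)]
    refine Real.log_le_log two_pos ?_
    rw [div_mul_div_comm, one_mul, le_div_iff₀ (by positivity)]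
    linarith
  have h5 : Real.log (α ^ 2 / 2) = -2 * Real.log (1 / α) - Real.log 2 := by
    rw [Real.log_div (by positivity) two_ne_zero, Real.log_pow, one_div, Real.log_inv]
    push_cast
    ring
  rw [h5] at h1
  -- `h4` and `2 log 2 > 1`: one of the two copies of `log(1/α)` pays for `log(a/d)` and the
  -- constant.
  have h6 : Real.log (1 / α) ≤
      2 * Real.log (1 / α) + Real.log 2 + Real.log (a / d) - 1 := by
    linarith [Real.log_two_gt_d9]
  have h7 := mul_le_mul hAb h6 hl0 ha.le
  nlinarith

end SmallInitialisation

/-! ### The degenerate case of a zero interpolator -/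

section Zero

variable {n d b : ℕ} {x : Fin n → Fin d → ℝ} {y : Fin n → ℝ} {α γ : ℝ} {B : ℕ → Batch n b}

/-- While `v = 0` the gradient vanishes, so SGD never moves. -/
theorem iterate_eq_zero (h : (0 : Fin d → ℝ) ∈ interpolators x y) (k : ℕ) :
    iterate x y α γ B k = 0 := by
  suffices h1 : (neurons x y α γ B k).2 = 0 by rw [iterate, h1, mul_zero]
  induction k with
  | zero => rfl
  | succ k ih =>
    simp [neurons, neuronGrad, ih, batchGrad_eq h]

theorem loss_zero (h : (0 : Fin d → ℝ) ∈ interpolators x y) : loss x y 0 = 0 := by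
  have h1 := loss_eq h 0
  simp only [sub_zero, Matrix.mulVec_zero, dotProduct_zero] at h1
  linarith

end Zero

/-! ### Dependence on finitely many batches -/

section Congr

variable {n d b : ℕ} {x : Fin n → Fin d → ℝ} {y : Fin n → ℝ} {α γ : ℝ} {B B' : ℕ → Batch n b}

theorem neurons_congr {k : ℕ} (h : ∀ i < k, B i = B' i) :
    neurons x y α γ B k = neurons x y α γ B' k := by
  induction k with
  | zero => rfl
  | succ k ih =>
    rw [neurons, neurons, ih fun i hi => h i (by omega), h k (by omega)]

theorem iterate_congr {k : ℕ} (h : ∀ i < k, B i = B' i) :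
    iterate x y α γ B k = iterate x y α γ B' k := by
  rw [iterate, iterate, neurons_congr h]

theorem scaledGrad_congr {k : ℕ} (h : ∀ i < k + 1, B i = B' i) :
    scaledGrad x y α γ B k = scaledGrad x y α γ B' k := by
  rw [scaledGrad, scaledGrad, iterate_congr fun i hi => h i (by omega), h k (by omega)]

end Congr

/-! ### Averaging out the current batch -/

section Sampling

variable {n b : ℕ} {Ω : Type*} [MeasurableSpace Ω] {P : Measure Ω} {𝓑 : ℕ → Ω → Batch n b}

instance : DiscreteMeasurableSpace (Batch n b) := ⟨fun _ => trivial⟩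

theorem nonempty_batch (hbn : b ≤ n) : Nonempty (Batch n b) := by
  rw [← Fintype.card_pos_iff, card_batch]
  exact Nat.choose_pos hbn

/-- Extends the first `k` batches of a sequence by copies of `B₀`. -/
noncomputable def extend (B₀ : Batch n b) (k : ℕ) (z : Finset.range k → Batch n b) :
    ℕ → Batch n b :=
  fun i => if h : i ∈ Finset.range k then z ⟨i, h⟩ else B₀

theorem extend_of_lt (B₀ : Batch n b) (k : ℕ) (B : ℕ → Batch n b) {i : ℕ} (hi : i < k) :
    extend B₀ k (fun i => B i) i = B i := by
  simp [extend, hi]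

/-- A function of finitely many of the batches is measurable. -/
theorem IsUniformSampling.measurable_of_prefix [Nonempty (Batch n b)]
    (hs : IsUniformSampling P 𝓑) {M : Type*} [MeasurableSpace M] (k : ℕ)
    (G : (ℕ → Batch n b) → M) (hG : ∀ B B' : ℕ → Batch n b, (∀ i < k, B i = B' i) → G B = G B') :
    Measurable fun ω => G fun i => 𝓑 i ω := by
  obtain ⟨B₀⟩ := ‹Nonempty (Batch n b)›
  have h : (fun ω => G fun i => 𝓑 i ω) =
      (fun z => G (extend B₀ k z)) ∘ fun ω (i : Finset.range k) => 𝓑 i ω := by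
    funext ω
    exact hG _ _ fun i hi => (extend_of_lt B₀ k (fun i => 𝓑 i ω) hi).symm
  rw [h]
  exact (measurable_of_countable _).comp (measurable_pi_lambda _ fun i => hs.measurable i)

theorem IsUniformSampling.measure_eq (hs : IsUniformSampling P 𝓑) (k : ℕ) (A : Batch n b) :
    P (𝓑 k ⁻¹' {A}) = (Fintype.card (Batch n b) : ℝ≥0∞)⁻¹ := by
  rw [← Measure.map_apply (hs.measurable k) (MeasurableSet.singleton A), hs.uniform k,
    uniformOn_univ]
  simp

/-- The batch of step `k` may be averaged out, as it is independent of the earlier ones. -/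
theorem IsUniformSampling.lintegral_eq [Nonempty (Batch n b)]
    (hs : IsUniformSampling P 𝓑) (k : ℕ) (F : (ℕ → Batch n b) → Batch n b → ℝ≥0∞)
    (hF : ∀ B B' : ℕ → Batch n b, (∀ i < k, B i = B' i) → F B = F B') :
    ∫⁻ ω, F (fun i => 𝓑 i ω) (𝓑 k ω) ∂P =
      ∫⁻ ω, (Fintype.card (Batch n b) : ℝ≥0∞)⁻¹ * ∑ A, F (fun i => 𝓑 i ω) A ∂P := by
  classical
  have hmeas : ∀ A, Measurable fun ω => F (fun i => 𝓑 i ω) A := fun A =>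
    hs.measurable_of_prefix k (fun B => F B A) fun B B' h => congrFun (hF B B' h) A
  have hA : ∀ A, MeasurableSet (𝓑 k ⁻¹' {A}) := fun A =>
    hs.measurable k (MeasurableSet.singleton A)
  have h1 : ∀ ω, F (fun i => 𝓑 i ω) (𝓑 k ω) =
      ∑ A, F (fun i => 𝓑 i ω) A * (𝓑 k ⁻¹' {A}).indicator 1 ω := by
    -- Splitting over the value of the current batch leaves products of a function of the past and
    -- an independent indicator.
    intro ω
    rw [Finset.sum_eq_single (𝓑 k ω)]
    · simp
    · intro A _ hne
      simp [Set.indicator, hne.symm]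
    · simp
  simp only [h1]
  have h2 : ∀ A, Measurable fun ω =>
      F (fun i => 𝓑 i ω) A * (𝓑 k ⁻¹' {A}).indicator (1 : Ω → ℝ≥0∞) ω :=
    fun A => (hmeas A).mul (measurable_one.indicator (hA A))
  rw [lintegral_finsetSum _ fun A _ => h2 A,
    lintegral_const_mul _ (Finset.measurable_sum _ fun A _ => hmeas A),
    lintegral_finsetSum _ fun A _ => hmeas A, Finset.mul_sum]
  refine Finset.sum_congr rfl fun A _ => ?_
  have hindep : IndepFun (fun ω => F (fun i => 𝓑 i ω) A)
      (fun ω => (𝓑 k ⁻¹' {A}).indicator (1 : Ω → ℝ≥0∞) ω) P := by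
    have h2 := hs.indep.indepFun_finset (Finset.range k) {k} (by simp) hs.measurable
    have h3 := h2.comp (φ := fun z => F (extend A k z) A)
      (ψ := fun z => if z ⟨k, by simp⟩ = A then (1 : ℝ≥0∞) else 0)
      (measurable_of_countable _) (measurable_of_countable _)
    convert h3 using 1
    · funext ω
      exact congrFun (hF _ _ fun i hi => (extend_of_lt A k (fun i => 𝓑 i ω) hi).symm) A
    · funext ω
      simp [Set.indicator]
  rw [lintegral_mul_eq_lintegral_mul_lintegral_of_indepFun'' (hmeas A).aemeasurable
    (measurable_one.indicator (hA A)).aemeasurable hindep, lintegral_indicator_one (hA A),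
    hs.measure_eq, mul_comm]

theorem inv_card_mul_sum_ofReal {f : Batch n b → ℝ} (hf : ∀ A, 0 ≤ f A) :
    (Fintype.card (Batch n b) : ℝ≥0∞)⁻¹ * ∑ A, ENNReal.ofReal (f A) =
      ENNReal.ofReal (1 / (Fintype.card (Batch n b) : ℝ) * ∑ A, f A) := by
  rcases isEmpty_or_nonempty (Batch n b) with h | h
  · simp
  · rw [← ENNReal.ofReal_sum_of_nonneg fun A _ => hf A, ENNReal.ofReal_mul (by positivity),
      one_div, ENNReal.ofReal_inv_of_pos (by exact_mod_cast Fintype.card_pos),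
      ENNReal.ofReal_natCast]

end Sampling

/-! ### Expected gain and expected losses -/

section Expectation

variable {n d b : ℕ} {x : Fin n → Fin d → ℝ} {y : Fin n → ℝ} {α γ : ℝ}
  {Ω : Type*} [MeasurableSpace Ω] {P : Measure Ω} {𝓑 : ℕ → Ω → Batch n b}

theorem lintegral_batchLoss (hs : IsUniformSampling P 𝓑) (hb : 1 ≤ b) (hbn : b ≤ n) (k : ℕ) :
    ∫⁻ ω, ENNReal.ofReal (batchLoss x y (𝓑 k ω).1 (iterate x y α γ (fun i => 𝓑 i ω) k)) ∂P =
      ∫⁻ ω, ENNReal.ofReal (loss x y (iterate x y α γ (fun i => 𝓑 i ω) k)) ∂P := by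
  have := nonempty_batch hbn
  rw [hs.lintegral_eq k
    (fun B A => ENNReal.ofReal (batchLoss x y A.1 (iterate x y α γ B k)))
    fun B B' h => by rw [iterate_congr h]]
  refine lintegral_congr fun ω => ?_
  rw [inv_card_mul_sum_ofReal fun A => batchLoss_nonneg _ _, sum_batchLoss hb hbn]
  have hc : (Fintype.card (Batch n b) : ℝ) ≠ 0 := by exact_mod_cast Fintype.card_ne_zero
  congr 1
  field_simp

theorem lintegral_sum_scaledGrad_sq {β' : Fin d → ℝ} (h' : β' ∈ interpolators x y)
    (hs : IsUniformSampling P 𝓑) (hbn : b ≤ n) (k : ℕ) :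
    ∫⁻ ω, ENNReal.ofReal (∑ j, scaledGrad x y α γ (fun i => 𝓑 i ω) k j ^ 2) ∂P =
      ∫⁻ ω, ENNReal.ofReal (γ ^ 2 * ((iterate x y α γ (fun i => 𝓑 i ω) k - β') ⬝ᵥ
        (meanSqHessian x b *ᵥ (iterate x y α γ (fun i => 𝓑 i ω) k - β')))) ∂P := by
  have := nonempty_batch hbn
  refine (hs.lintegral_eq k (fun B A => ENNReal.ofReal
    (∑ j, (γ • batchGrad x y A.1 (iterate x y α γ B k)) j ^ 2))
    fun B B' h => by rw [iterate_congr h]).trans (lintegral_congr fun ω => ?_)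
  rw [inv_card_mul_sum_ofReal fun A => by positivity, dotProduct_meanSqHessian_mulVec]
  simp only [batchGrad_eq h', Pi.smul_apply, smul_eq_mul, mul_pow, ← Finset.mul_sum]
  congr 1
  ring

theorem expectedLossSum_eq (hs : IsUniformSampling P 𝓑) (hbn : b ≤ n) :
    expectedLossSum x y α γ P 𝓑 =
      ∑' k, ∫⁻ ω, ENNReal.ofReal (loss x y (iterate x y α γ (fun i => 𝓑 i ω) k)) ∂P := by
  have := nonempty_batch hbn
  refine lintegral_tsum fun k => (hs.measurable_of_prefix k
    (fun B => ENNReal.ofReal (loss x y (iterate x y α γ B k)))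
    fun B B' h => by rw [iterate_congr h]).aemeasurable

theorem expectedLossSum_eq_lintegral_batchLoss (hs : IsUniformSampling P 𝓑) (hb : 1 ≤ b)
    (hbn : b ≤ n) : expectedLossSum x y α γ P 𝓑 = ∫⁻ ω, ∑' k,
      ENNReal.ofReal (batchLoss x y (𝓑 k ω).1 (iterate x y α γ (fun i => 𝓑 i ω) k)) ∂P := by
  have := nonempty_batch hbn
  rw [expectedLossSum_eq hs hbn, lintegral_tsum fun k => (hs.measurable_of_prefix (k + 1)
    (fun B => ENNReal.ofReal (batchLoss x y (B k).1 (iterate x y α γ B k)))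
    fun B B' h => by
      rw [iterate_congr fun i hi => h i (by omega), h k (by omega)]).aemeasurable]
  exact tsum_congr fun k => (lintegral_batchLoss hs hb hbn k).symm

theorem expectedGain_eq (hs : IsUniformSampling P 𝓑) (hbn : b ≤ n) :
    expectedGain x y α γ P 𝓑 =
      ∑' k, ∫⁻ ω, ∑ j, (q (scaledGrad x y α γ (fun i => 𝓑 i ω) k j)).toENNReal ∂P := by
  have := nonempty_batch hbn
  simp only [expectedGain, gain]
  rw [← lintegral_tsum fun k => (hs.measurable_of_prefix (k + 1)
    (fun B => ∑ j, (q (scaledGrad x y α γ B k j)).toENNReal)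
    fun B B' h => by rw [scaledGrad_congr h]).aemeasurable]
  refine lintegral_congr fun ω => ?_
  rw [Summable.tsum_finsetSum fun j _ => ENNReal.summable]

/-- `q(t) = -log(1 - t²)`, and `t² ≤ 1/4`. -/
theorem toENNReal_q_bounds {t : ℝ} (ht : |t| ≤ 1 / 2) :
    ENNReal.ofReal (t ^ 2) ≤ (q t).toENNReal ∧
      (q t).toENNReal ≤ ENNReal.ofReal (2 * t ^ 2) := by
  have h1 : t ^ 2 ≤ 1 / 4 := by
    rw [← sq_abs]
    nlinarith [abs_nonneg t]
  have h2 : 0 < 1 - t ^ 2 := by linarith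
  have h3 : t ^ 2 ≠ 1 := by linarith
  rw [q, if_neg h3, EReal.toENNReal_of_ne_top (EReal.coe_ne_top _), EReal.toReal_coe,
    Real.log_pow]
  have h4 := Real.log_le_sub_one_of_pos h2
  have h5 := Real.one_sub_inv_le_log_of_pos h2
  have h6 : (1 - t ^ 2)⁻¹ ≤ 1 + 2 * t ^ 2 := by
    rw [inv_le_iff_one_le_mul₀ h2]
    nlinarith [sq_nonneg t]
  push_cast
  constructor <;> refine ENNReal.ofReal_le_ofReal ?_ <;> linarith

/-- The expected gain is comparable to the expected sum of the losses. -/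
theorem expectedGain_bounds (hbn : b ≤ n) (hI : (interpolators x y).Nonempty)
    (hg : ∀ (B : ℕ → Batch n b) (k : ℕ), ‖scaledGrad x y α γ B k‖ ≤ 1 / 2)
    (hs : IsUniformSampling P 𝓑) :
    ENNReal.ofReal (lamMin x b * γ ^ 2) * expectedLossSum x y α γ P 𝓑 ≤
        expectedGain x y α γ P 𝓑 ∧
      expectedGain x y α γ P 𝓑 ≤
        ENNReal.ofReal (4 * lamMax x b * γ ^ 2) * expectedLossSum x y α γ P 𝓑 := by
  obtain ⟨β', h'⟩ := hI
  rw [expectedLossSum_eq hs hbn, expectedGain_eq hs hbn, ← ENNReal.tsum_mul_left,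
    ← ENNReal.tsum_mul_left]
  constructor <;> refine ENNReal.tsum_le_tsum fun k => ?_ <;>
    rw [← lintegral_const_mul' _ _ ENNReal.ofReal_ne_top]
  · calc _ ≤ ∫⁻ ω, ENNReal.ofReal (γ ^ 2 * ((iterate x y α γ (fun i => 𝓑 i ω) k - β') ⬝ᵥ
          (meanSqHessian x b *ᵥ (iterate x y α γ (fun i => 𝓑 i ω) k - β')))) ∂P := by
          refine lintegral_mono fun ω => ?_
          rw [← ENNReal.ofReal_mul' (loss_nonneg _)]
          refine ENNReal.ofReal_le_ofReal ?_
          have h1 := lamMin_mul_le x b (iterate x y α γ (fun i => 𝓑 i ω) k - β')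
          rw [← loss_eq h'] at h1
          -- The form of `H` is twice the loss; nonnegativity allows this factor two to be dropped.
          have h2 := meanSqHessian_form_nonneg x b (iterate x y α γ (fun i => 𝓑 i ω) k - β')
          rw [mul_comm (lamMin x b), mul_assoc]
          refine mul_le_mul_of_nonneg_left ?_ (sq_nonneg γ)
          linarith
      _ = _ := (lintegral_sum_scaledGrad_sq h' hs hbn k).symm
      _ ≤ _ := by
          refine lintegral_mono fun ω => ?_
          rw [ENNReal.ofReal_sum_of_nonneg fun j _ => sq_nonneg _]
          exact Finset.sum_le_sum fun j _ =>
            (toENNReal_q_bounds (abs_le_of_norm_le (hg _ k) j)).1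
  · calc _ ≤ ∫⁻ ω, 2 * ENNReal.ofReal
          (∑ j, scaledGrad x y α γ (fun i => 𝓑 i ω) k j ^ 2) ∂P := by
          refine lintegral_mono fun ω => ?_
          rw [ENNReal.ofReal_sum_of_nonneg fun j _ => sq_nonneg _, Finset.mul_sum]
          refine Finset.sum_le_sum fun j _ => ?_
          refine (toENNReal_q_bounds (abs_le_of_norm_le (hg _ k) j)).2.trans (le_of_eq ?_)
          rw [ENNReal.ofReal_mul two_pos.le, ENNReal.ofReal_ofNat]
      _ = 2 * ∫⁻ ω, ENNReal.ofReal (γ ^ 2 * ((iterate x y α γ (fun i => 𝓑 i ω) k - β') ⬝ᵥ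
          (meanSqHessian x b *ᵥ (iterate x y α γ (fun i => 𝓑 i ω) k - β')))) ∂P := by
          rw [lintegral_const_mul' _ _ (by simp), lintegral_sum_scaledGrad_sq h' hs hbn]
      _ = ∫⁻ ω, 2 * ENNReal.ofReal (γ ^ 2 * ((iterate x y α γ (fun i => 𝓑 i ω) k - β') ⬝ᵥ
          (meanSqHessian x b *ᵥ (iterate x y α γ (fun i => 𝓑 i ω) k - β')))) ∂P := by
          rw [lintegral_const_mul' _ _ (by simp)]
      _ ≤ _ := by
          refine lintegral_mono fun ω => ?_
          rw [← ENNReal.ofReal_mul' (loss_nonneg _), ← ENNReal.ofReal_ofNat,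
            ← ENNReal.ofReal_mul two_pos.le]
          refine ENNReal.ofReal_le_ofReal ?_
          have h1 := le_lamMax_mul x b (iterate x y α γ (fun i => 𝓑 i ω) k - β')
          rw [← loss_eq h'] at h1
          have h2 := mul_le_mul_of_nonneg_left h1 (sq_nonneg γ)
          linarith

/-- Bounds on the batch losses along all trajectories bound the expected sum of the losses. -/
theorem expectedLossSum_bounds [IsProbabilityMeasure P] (hs : IsUniformSampling P 𝓑) (hb : 1 ≤ b)
    (hbn : b ≤ n) (hγ : 0 < γ) {D : ℝ}
    (hupper : ∀ (B : ℕ → Batch n b) (k : ℕ), 2 * γ *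
      ∑ i ∈ Finset.range k, batchLoss x y (B i).1 (iterate x y α γ B i) ≤ 3 * D)
    (hlower : ∀ B : ℕ → Batch n b,
      Filter.Tendsto (fun k => loss x y (iterate x y α γ B k)) Filter.atTop (nhds 0) →
      ∀ C : ℝ, (∀ k, 4 * γ *
        ∑ i ∈ Finset.range k, batchLoss x y (B i).1 (iterate x y α γ B i) ≤ C) → D ≤ C) :
    ENNReal.ofReal (1 / 4 * (γ * D)) ≤ ENNReal.ofReal (γ ^ 2) * expectedLossSum x y α γ P 𝓑 ∧
      ENNReal.ofReal (γ ^ 2) * expectedLossSum x y α γ P 𝓑 ≤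
        ENNReal.ofReal (3 / 2 * (γ * D)) := by
  have hsum : ∀ (B : ℕ → Batch n b) (k : ℕ), ∑ i ∈ Finset.range k,
      ENNReal.ofReal (batchLoss x y (B i).1 (iterate x y α γ B i)) =
      ENNReal.ofReal (∑ i ∈ Finset.range k, batchLoss x y (B i).1 (iterate x y α γ B i)) :=
    fun B k => (ENNReal.ofReal_sum_of_nonneg fun i _ => batchLoss_nonneg _ _).symm
  have hle : expectedLossSum x y α γ P 𝓑 ≤ ENNReal.ofReal (3 * D / (2 * γ)) := by
    rw [expectedLossSum_eq_lintegral_batchLoss hs hb hbn]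
    have h1 : ∀ B : ℕ → Batch n b, ∑' i,
        ENNReal.ofReal (batchLoss x y (B i).1 (iterate x y α γ B i)) ≤
        ENNReal.ofReal (3 * D / (2 * γ)) := fun B =>
      ENNReal.tsum_le_of_sum_range_le fun k => by
        rw [hsum]
        refine ENNReal.ofReal_le_ofReal ?_
        rw [le_div_iff₀ (by positivity), mul_comm]
        exact hupper B k
    refine (lintegral_mono fun ω => h1 fun i => 𝓑 i ω).trans ?_
    simp
  have hge : ENNReal.ofReal (D / (4 * γ)) ≤ expectedLossSum x y α γ P 𝓑 := by
    have := nonempty_batch hbn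
    have hfin : expectedLossSum x y α γ P 𝓑 ≠ ∞ := ne_top_of_le_ne_top ENNReal.ofReal_ne_top hle
    -- The upper bound makes the expected sum finite, so almost surely the losses are summable and
    -- tend to zero, as `hlower` requires.
    have hae := ae_lt_top (Measurable.tsum fun k => hs.measurable_of_prefix k
      (fun B => ENNReal.ofReal (loss x y (iterate x y α γ B k)))
      fun B B' h => by rw [iterate_congr h]) hfin
    rw [expectedLossSum_eq_lintegral_batchLoss hs hb hbn]
    have h1 : ∫⁻ _, ENNReal.ofReal (D / (4 * γ)) ∂P = ENNReal.ofReal (D / (4 * γ)) := by simp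
    rw [← h1]
    refine lintegral_mono_ae ?_
    filter_upwards [hae] with ω hω
    have hlim : Filter.Tendsto (fun k => loss x y (iterate x y α γ (fun i => 𝓑 i ω) k))
        Filter.atTop (nhds 0) := by
      have h2 := (ENNReal.tendsto_toReal ENNReal.zero_ne_top).comp
        (ENNReal.tendsto_atTop_zero_of_tsum_ne_top hω.ne)
      refine (h2.congr fun k => ?_)
      exact ENNReal.toReal_ofReal (loss_nonneg _)
    by_contra! hlt
    set T := ∑' k,
      ENNReal.ofReal (batchLoss x y (𝓑 k ω).1 (iterate x y α γ (fun i => 𝓑 i ω) k)) with hT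
    have hTfin : T ≠ ∞ := hlt.ne_top
    have h2 := hlower (fun i => 𝓑 i ω) hlim (4 * γ * T.toReal) fun k => by
      refine mul_le_mul_of_nonneg_left ?_ (by positivity)
      rw [← ENNReal.ofReal_le_iff_le_toReal hTfin, ← hsum fun i => 𝓑 i ω]
      exact ENNReal.sum_le_tsum _
    have h3 : D / (4 * γ) ≤ T.toReal := by
      rw [div_le_iff₀ (by positivity), mul_comm]
      exact h2
    exact absurd hlt (not_lt.2 ((ENNReal.ofReal_le_iff_le_toReal hTfin).2 h3))
  have hγ2 : 0 ≤ γ ^ 2 := sq_nonneg γ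
  constructor
  · refine le_trans (le_of_eq ?_) (mul_le_mul_right hge _)
    rw [← ENNReal.ofReal_mul hγ2]
    congr 1
    field_simp
  · refine (mul_le_mul_right hle _).trans (le_of_eq ?_)
    rw [← ENNReal.ofReal_mul hγ2]
    congr 1
    field_simp

end Expectation

end DLN

/-! ### The proposition -/

theorem mainTheorem4 :
    (∀ (n d b : ℕ) (x : Fin n → Fin d → ℝ) (y : Fin n → ℝ) (α γ : ℝ),
      1 ≤ b → b ≤ n → (DLN.interpolators x y).Nonempty → 0 < α → 0 < γ →
      (∀ (B : ℕ → DLN.Batch n b) (k : ℕ), ‖DLN.scaledGrad x y α γ B k‖ ≤ 1 / 2) →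
      ∀ (Ω : Type*) [MeasurableSpace Ω] (P : Measure Ω) [IsProbabilityMeasure P]
        (𝓑 : ℕ → Ω → DLN.Batch n b), DLN.IsUniformSampling P 𝓑 →
        ENNReal.ofReal (DLN.lamMin x b * γ ^ 2) * DLN.expectedLossSum x y α γ P 𝓑 ≤
            DLN.expectedGain x y α γ P 𝓑 ∧
          DLN.expectedGain x y α γ P 𝓑 ≤
            ENNReal.ofReal (4 * DLN.lamMax x b * γ ^ 2) * DLN.expectedLossSum x y α γ P 𝓑) ∧
    ∃ c C₁ C₂ : ℝ, 0 < c ∧ 0 < C₁ ∧ 0 < C₂ ∧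
      ∀ (n d : ℕ) (x : Fin n → Fin d → ℝ) (y : Fin n → ℝ) (βs : Fin d → ℝ),
        DLN.IsMinL1Interpolator x y βs →
        ∃ α₀ : ℝ, 0 < α₀ ∧ ∀ (α : ℝ) (b : ℕ) (L : ℝ), 0 < α → α ≤ α₀ → 1 ≤ b → b ≤ n →
          DLN.IsSmoothness x b L →
          (∀ B₀ γ : ℝ,
            B₀ = 3 * DLN.l1Norm βs * Real.log (1 + DLN.l1Norm βs / α ^ 2) →
            0 < γ → γ * (B₀ * L) ≤ c →
            ‖βs‖ ≤ B₀ ∧ ∀ (B : ℕ → DLN.Batch n b) (k : ℕ), ‖DLN.iterate x y α γ B k‖ ≤ B₀) ∧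
          (∀ B₀ γ : ℝ, ‖βs‖ ≤ B₀ → 0 < γ → γ * (B₀ * L) ≤ c →
            (∀ (B : ℕ → DLN.Batch n b) (k : ℕ), ‖DLN.iterate x y α γ B k‖ ≤ B₀) →
            (∀ (B : ℕ → DLN.Batch n b) (k : ℕ), ‖DLN.scaledGrad x y α γ B k‖ ≤ 1 / 2) ∧
            ∀ (Ω : Type*) [MeasurableSpace Ω] (P : Measure Ω) [IsProbabilityMeasure P]
              (𝓑 : ℕ → Ω → DLN.Batch n b), DLN.IsUniformSampling P 𝓑 →
              ENNReal.ofReal (C₁ * (γ * Real.log (1 / α) * DLN.l1Norm βs)) ≤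
                  ENNReal.ofReal (γ ^ 2) * DLN.expectedLossSum x y α γ P 𝓑 ∧
                ENNReal.ofReal (γ ^ 2) * DLN.expectedLossSum x y α γ P 𝓑 ≤
                  ENNReal.ofReal (C₂ * (γ * Real.log (1 / α) * DLN.l1Norm βs))) := by
  refine ⟨fun n d b x y α γ _ hbn hI _ _ hg Ω _ P _ 𝓑 hs =>
    DLN.expectedGain_bounds hbn hI hg hs, 1 / 8, 1 / 4, 3 / 2, by norm_num, by norm_num,
    by norm_num, fun n d x y βs hβs => ?_⟩
  rcases eq_or_ne βs 0 with rfl | hne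
  · have hI := hβs.1
    refine ⟨1, one_pos, fun α b L _ _ _ _ _ => ⟨fun B₀ γ hB₀ _ _ => ?_,
      fun B₀ γ _ _ _ _ => ⟨fun B k => ?_, fun Ω _ P _ 𝓑 _ => ?_⟩⟩⟩
    · have h0 : B₀ = 0 := by simp [hB₀, DLN.l1Norm]
      simp [h0, DLN.iterate_eq_zero hI]
    · simp [DLN.scaledGrad, DLN.iterate_eq_zero hI, DLN.batchGrad_eq hI]
    · simp [DLN.l1Norm, DLN.expectedLossSum, DLN.iterate_eq_zero hI, DLN.loss_zero hI]
  have hA : 0 < DLN.l1Norm βs := DLN.l1Norm_pos hne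
  have hnorm : 0 < ‖βs‖ := norm_pos_iff.2 hne
  have hd : (1 : ℝ) ≤ d := by
    rcases Nat.eq_zero_or_pos d with rfl | hd
    · simp [DLN.l1Norm] at hA
    · exact_mod_cast hd
  -- `α ≤ 1` gives `α² ≤ α` and `log(1/α) ≥ 0`; `‖βs‖` gives `α² ≤ B₀`; `A / (6d)` makes the initial
  -- mass small against `A = ‖βs‖₁`; `1 / (2A)` gives `log(2A) ≤ log(1/α)`.
  have hα₀ : 0 < min (min 1 ‖βs‖) (min (DLN.l1Norm βs / (6 * d)) (1 / (2 * DLN.l1Norm βs))) := by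
    positivity
  refine ⟨_, hα₀, fun α b L hα hle hb hbn hL => ?_⟩
  simp only [le_min_iff] at hle
  obtain ⟨⟨hα1, hα2⟩, hα3, hα4⟩ := hle
  rw [le_div_iff₀ (by positivity)] at hα3 hα4
  have hsq : α ^ 2 ≤ α := by nlinarith
  have h6 : 6 * α ^ 2 ≤ DLN.l1Norm βs := by nlinarith
  have hdα : d * α ^ 2 ≤ DLN.l1Norm βs := by nlinarith
  have hdα' : 2 * d * α ≤ DLN.l1Norm βs := by nlinarith
  refine ⟨fun B₀ γ hB₀ hγ hγB => ⟨?_, fun B k =>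
    DLN.norm_iterate_le hβs.1 hL hα hγ h6 hdα hB₀ hγB k⟩, fun B₀ γ hB₀ hγ hγB hk => ?_⟩
  · rw [hB₀]
    exact (DLN.norm_le_l1Norm βs).trans (DLN.le_three_mul_log hα h6)
  have hg : ∀ (B : ℕ → DLN.Batch n b) (k : ℕ), ‖DLN.scaledGrad x y α γ B k‖ ≤ 1 / 2 :=
    fun B k => DLN.norm_scaledGrad_le hβs.1 hL hγ hB₀ hγB k (hk B k)
  refine ⟨hg, fun Ω _ P _ 𝓑 hs => ?_⟩
  have key := DLN.expectedLossSum_bounds (D := DLN.l1Norm βs * Real.log (1 / α)) hs hb hbn hγ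
    (fun B k => DLN.sum_batchLoss_le hβs.1 hL hα hγ hA hdα (by linarith) hB₀
      (hsq.trans (hα2.trans hB₀)) hγB (hk B) k)
    (fun B hlim C hC => DLN.le_of_forall_sum_batchLoss_le hβs hα hα1 hA hdα' (hg B) (hk B) hlim hC)
  rwa [mul_comm (DLN.l1Norm βs), ← mul_assoc γ] at key
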